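/- **Setting.** For probability distributions $P,Q$ on $\{0,1\}^n$ let $d_{TV}(P,Q)=\frac12\sum_i|P(i)-Q(i)|$ and $d_\infty(P,Q)=\max_i|Q(i)/P(i)-1|$, where the ratio is read as $1$ if $P(i)=Q(i)=0$ and as $\infty$ if $P(i)=0<Q(i)$. An algorithm has $\mathsf{DUAL}$ access to $P$ if it can draw samples from $P$ and ask for the value $P(i)$ of any $i$. It has $\mathsf{PCOND}+\mathsf{SAMP}$ access to $Q$ if it can draw samples from $Q$ and, for any two distinct elements $a,b$ with $Q(\{a,b\})>0$, samples from $Q$ conditioned on $\{a,b\}$. Each sample and each value asked for counts as one query. **The algorithm** $\mathsf{Barbarik3}(P,Q,\eta,\varepsilon,\delta)$. 1. Let $k=n+\lceil\log_2(100/\eta)\rceil$, $S_i=\{b: 2^{-i}<P(b)\le 2^{-i+1}\}$ for $1\le i\le k$, $S_0=\{0,1\}^n\setminus\bigcup_{i=1}^k S_i$, $\theta=\eta/20$ and $\delta'=\delta/2$. 2. Draw $N=\left\lceil\max\left(\frac{4(k+1)}{\theta^2},\frac{8\ln(4/\delta')}{\theta^2}\right)\right\rceil$ samples from each of $P$ and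 $Q$, find the index of the set $S_i$ in which each lies (by asking for its $P$-value), and let $\hat d$ be the total variation distance between the two empirical distributions of the indices on $\{0,\dots,k\}$. If $\hat d>\varepsilon/2+\theta$, return $\mathsf{Reject}$. 3. Let $\varepsilon_2=\hat d+\theta$, $x=\frac{2\varepsilon}{1-\varepsilon}$, $\varepsilon_1=(0.99\eta-3.25\varepsilon_2-x)/1.05+x$, $m=\lceil\sqrt k/(0.99\eta-3.25\varepsilon_2-\varepsilon_1)\rceil$, $\alpha=(\varepsilon_1+x)/2$ and $t=\left\lceil\frac{\ln(4/\delta')}{\ln(10/(10-\varepsilon_1+\alpha))}\right\rceil$. 4. Repeat $t$ times: draw $m$ samples from $P$ and $m$ samples from $Q$ and ask for their $P$-values. For each $j=1,\dots,k$ such that $S_j$ contains samples of both kinds, let $p$ be the first sample from $P$ and $q$ the first sample from $Q$ that lie in $S_j$, and let $h=\frac{P(p)}{P(p)+P(q)(1+x)}$, $\ell=\frac{P(p)}{P(p)+P(q)(1+\alpha)}$, $r=\left\lceil\frac{2\ln(4mt/\delta')}{(h-\ell)^2}\right\rceil$. If $p=q$ let $\hat c=\frac12$; otherwise let $\hat c$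 be the fraction of times that $p$ occurs among $r$ samples from $Q$ conditioned on $\{p,q\}$. If $\hat c\le (h+\ell)/2$, return $\mathsf{Reject}$. 5. Return $\mathsf{Accept}$. **Theorem.** Let $\eta\in(0,1]$, $\varepsilon\in[0,\eta/11.6)$, $\delta\in(0,1/2]$, and let $P,Q$ be probability distributions on $\{0,1\}^n$. $\mathsf{Barbarik3}(P,Q,\eta,\varepsilon,\delta)$ uses only $\mathsf{DUAL}$ access to $P$ and $\mathsf{PCOND}+\mathsf{SAMP}$ access to $Q$. With probability at least $1-\delta$ it returns $\mathsf{Accept}$ if $d_\infty(P,Q)\le\varepsilon$, and with probability at least $1-\delta$ it returns $\mathsf{Reject}$ if $d_{TV}(P,Q)>\eta$. Moreover, for $n\ge2$ its query complexity is $$\tilde O\left(\frac{\sqrt n\,\log n}{\eta^3(\eta-11.6\,\varepsilon)}+\frac{n}{\eta^2}\right),$$ where $\tilde O$ hides factors polylogarithmic in $1/\eta$ and $1/\delta$; that is, there are absolute constants $C,c$ such that for all $n\ge 2$, all such $\eta,\varepsilon,\delta$ and all $P,Q$ the algorithm never makes more than $$C\left(\left(1+\ln\tfrac1\eta\right)\left(1+\ln\tfrac1\delta\right)\right)^c\left(\frac{\sqrt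 n\,\ln n}{\eta^3(\eta-11.6\,\varepsilon)}+\frac{n}{\eta^2}\right)$$ queries. -/

import Mathlib

namespace Barbarik

/-- The Boolean hypercube `{0,1}^n`. -/
abbrev Cube (n : ℕ) : Type := Fin n → Bool

/-- The answer of a tester. -/
inductive Verdict : Type
  | accept
  | reject

/-! ### Distances between distributions -/

/-- Total variation distance, `1/2 * ∑ |P(i) - Q(i)|`. -/
noncomputable def dTV {n : ℕ} (P Q : PMF (Cube n)) : ℝ :=
  (1 / 2) * ∑ x : Cube n, |(P x).toReal - (Q x).toReal|

open Classical in
/-- Multiplicative distance of `Q` from `P`: the maximum of `|Q(i)/P(i) - 1|`.  Where `P(i) = 0`,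
the ratio is `1` if `Q(i) = 0` and infinite otherwise. -/
noncomputable def dInf {n : ℕ} (P Q : PMF (Cube n)) : ENNReal :=
  ⨆ x : Cube n,
    if P x = 0 then (if Q x = 0 then 0 else ⊤)
    else ENNReal.ofReal |(Q x).toReal / (P x).toReal - 1|

/-! ### Algorithms with oracle access -/

/-- Adaptive algorithms that have access to two distributions `P` and `Q` on `{0,1}^n` only through
oracles: `sampP` and `evalP` (together the DUAL oracle of `P`), `sampQ` (the SAMP oracle of `Q`)
and `pcondQ` (the PCOND oracle of `Q`, which is asked for a sample conditioned on a set `{a, b}`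
of exactly two elements).  The last argument says how to go on after the oracle's answer. -/
inductive OracleProg (n : ℕ) (α : Type) : Type
  | ret : α → OracleProg n α
  | sampP : (Cube n → OracleProg n α) → OracleProg n α
  | evalP : Cube n → (ℝ → OracleProg n α) → OracleProg n α
  | sampQ : (Cube n → OracleProg n α) → OracleProg n α
  | pcondQ : (a b : Cube n) → a ≠ b → (Cube n → OracleProg n α) → OracleProg n α

namespace OracleProg

variable {n : ℕ} {α β : Type}

/-- Sequential composition. -/
def bind : OracleProg n α → (α → OracleProg n β) → OracleProg n β
  | ret a, f => f a
  | sampP k, f => sampP fun x => (k x).bind f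
  | evalP x k, f => evalP x fun w => (k w).bind f
  | sampQ k, f => sampQ fun x => (k x).bind f
  | pcondQ a b h k, f => pcondQ a b h fun x => (k x).bind f

instance : Monad (OracleProg n) where
  pure := ret
  bind := bind

/-- Add one to the query counter of an outcome. -/
def tick (o : Option α × ℕ) : Option α × ℕ := (o.1, o.2 + 1)

open Classical in
/-- Execution of an algorithm with oracles for `P` and `Q`: the joint law of its output and of the
number of oracle queries that it makes.  All oracle answers are drawn independently.  The output
`none` stands for a failure: it is produced if the PCOND oracle is asked to condition on a set of
`Q`-probability zero, where the conditional distribution is undefined. -/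
noncomputable def run (P Q : PMF (Cube n)) : OracleProg n α → PMF (Option α × ℕ)
  | ret a => PMF.pure (some a, 0)
  | sampP k => (P.bind fun x => run P Q (k x)).map tick
  | evalP x k => (run P Q (k (P x).toReal)).map tick
  | sampQ k => (Q.bind fun x => run P Q (k x)).map tick
  | pcondQ a b _ k =>
      if h : ∃ x ∈ ({a, b} : Set (Cube n)), x ∈ Q.support then
        ((Q.filter {a, b} h).bind fun x => run P Q (k x)).map tick
      else PMF.pure (none, 1)

/-- The probability that the algorithm returns `a`. -/
noncomputable def probReturns (P Q : PMF (Cube n)) (A : OracleProg n α) (a : α) : ENNReal :=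
  ((A.run P Q).map Prod.fst) (some a)

/-- On input `P`, `Q`, the algorithm never makes more than `b` oracle queries. -/
def QueriesAtMost (P Q : PMF (Cube n)) (A : OracleProg n α) (b : ℝ) : Prop :=
  ∀ o ∈ (A.run P Q).support, (o.2 : ℝ) ≤ b

/-- Execute `A` `N` times, with fresh oracle answers, and list the results in order. -/
def repeatN (A : OracleProg n α) : ℕ → OracleProg n (List α)
  | 0 => pure []
  | N + 1 => do
      let a ← A
      let l ← repeatN A N
      return a :: l

/-- Run a test on the members of a list, one after the other; return `reject` as soon as one of
the tests does, and `accept` if none does. -/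
def allAccept (test : β → OracleProg n Verdict) : List β → OracleProg n Verdict
  | [] => pure Verdict.accept
  | b :: l => do
      match ← test b with
      | Verdict.reject => pure Verdict.reject
      | Verdict.accept => allAccept test l

end OracleProg

open OracleProg

/-! ### The tester -/

open Classical in
/-- The index of the bucket of an element of `P`-probability `w`: the `i` in `{1, …, k}` with
`2^(-i) < w ≤ 2^(-i+1)` if there is one, and `0` otherwise. -/
noncomputable def bucketIndex (k : ℕ) (w : ℝ) : ℕ :=
  if h : ∃ i : ℕ, 1 ≤ i ∧ i ≤ k ∧ (2 : ℝ) ^ (-(i : ℤ)) < w ∧ w ≤ (2 : ℝ) ^ (-(i : ℤ) + 1) then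
    Nat.find h
  else 0

/-- Draw `x` from `P` and look up `P(x)`. -/
def drawP (n : ℕ) : OracleProg n (Cube n × ℝ) :=
  sampP fun x => evalP x fun w => ret (x, w)

/-- Draw `x` from `Q` and look up `P(x)`. -/
def drawQ (n : ℕ) : OracleProg n (Cube n × ℝ) :=
  sampQ fun x => evalP x fun w => ret (x, w)

/-- A sample from the bucket distribution of `P`. -/
noncomputable def sampBP (n k : ℕ) : OracleProg n ℕ := do
  let x ← drawP n
  return bucketIndex k x.2

/-- A sample from the bucket distribution of `Q`. -/
noncomputable def sampBQ (n k : ℕ) : OracleProg n ℕ := do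
  let x ← drawQ n
  return bucketIndex k x.2

/-- Total variation distance on `{0, …, k}` between the empirical distributions of two lists of
`N` samples. -/
noncomputable def empiricalTV (k N : ℕ) (s t : List ℕ) : ℝ :=
  (1 / 2) * ∑ i ∈ Finset.range (k + 1), |(s.count i : ℝ) / N - (t.count i : ℝ) / N|

/-- The OutsideBucket subroutine: estimate the total variation distance between two distributions
on `{0, …, k}`, given by samplers. -/
noncomputable def outsideBucket {n : ℕ} (D₁ D₂ : OracleProg n ℕ) (k : ℕ) (θ δ : ℝ) :
    OracleProg n ℝ := do
  let N : ℕ := ⌈max (4 * ((k : ℝ) + 1) / θ ^ 2) (8 * Real.log (4 / δ) / θ ^ 2)⌉₊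
  let s ← repeatN D₁ N
  let t ← repeatN D₂ N
  return empiricalTV k N s t

/-- The Bias subroutine: the fraction of times that `p` is seen in `r` samples from `Q`
conditioned on `{p, q}`, and `1/2` if `p = q`. -/
noncomputable def bias {n : ℕ} (p q : Cube n) (r : ℕ) : OracleProg n ℝ :=
  if h : p = q then ret (1 / 2)
  else do
    let l ← repeatN (pcondQ p q h ret) r
    return (l.count p : ℝ) / r

open Classical in
/-- The test made by InsideBucket on a pair of samples that lie in the same bucket, each given with
its `P`-probability. -/
noncomputable def pairTest {n : ℕ} (ε α δ : ℝ) (m t : ℕ) (p q : Cube n × ℝ) :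
    OracleProg n Verdict := do
  let h : ℝ := p.2 / (p.2 + q.2 * (1 + 2 * ε / (1 - ε)))
  let l : ℝ := p.2 / (p.2 + q.2 * (1 + α))
  let r : ℕ := ⌈2 * Real.log (4 * m * t / δ) / (h - l) ^ 2⌉₊
  let c ← bias p.1 q.1 r
  return if c ≤ (h + l) / 2 then Verdict.reject else Verdict.accept

/-- One iteration of InsideBucket: draw `m` samples from each distribution and, for each bucket
`j` in `{1, …, k}` that is hit by both, test the first sample from `P` and the first sample from
`Q` that lie in it. -/
noncomputable def insideRound (n k : ℕ) (ε α δ : ℝ) (m t : ℕ) : OracleProg n Verdict := do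
  let gP ← repeatN (drawP n) m
  let gQ ← repeatN (drawQ n) m
  allAccept
    (fun j : ℕ =>
      match gP.find? (fun x => bucketIndex k x.2 == j), gQ.find? (fun x => bucketIndex k x.2 == j)
        with
      | some p, some q => pairTest ε α δ m t p q
      | _, _ => ret Verdict.accept)
    (List.range' 1 k)

/-- The InsideBucket subroutine. -/
noncomputable def insideBucket (n k : ℕ) (ε ε₂ η δ : ℝ) : OracleProg n Verdict :=
  let ε₁ : ℝ := (0.99 * η - 3.25 * ε₂ - 2 * ε / (1 - ε)) / 1.05 + 2 * ε / (1 - ε)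
  let m : ℕ := ⌈√(k : ℝ) / (0.99 * η - 3.25 * ε₂ - ε₁)⌉₊
  let α : ℝ := (ε₁ + 2 * ε / (1 - ε)) / 2
  let t : ℕ := ⌈Real.log (4 / δ) / Real.log (10 / (10 - ε₁ + α))⌉₊
  allAccept (fun _ : ℕ => insideRound n k ε α δ m t) (List.range t)

open Classical in
/-- The tester Barbarik3 for distributions on `{0,1}^n`, with farness `η`, closeness `ε` and
confidence `δ`. -/
noncomputable def barbarik3 (n : ℕ) (η ε δ : ℝ) : OracleProg n Verdict := do
  let k : ℕ := n + ⌈Real.logb 2 (100 / η)⌉₊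
  let θ : ℝ := η / 20
  let d ← outsideBucket (sampBP n k) (sampBQ n k) k θ (δ / 2)
  if ε / 2 + θ < d then
    return Verdict.reject
  else
    insideBucket n k ε (d + θ) η (δ / 2)

end Barbarik

/-!
The tester makes finitely many draws from finite distributions, so expectations of its output are
finite sums.  `ev` computes them by recursion on the program, `toReal_probReturns` ties them to the
law `run`, and `listE` is the expectation over a list of independent samples, to which `ev` of a
repeated sampler reduces.  With `QueryBound`, a bound on the number of queries that holds whatever
the oracles answer, all claims become statements about real numbers.

*OutsideBucket.*  Half the `ℓ¹` distance of the empirical and the true bucket distribution is the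
largest excess over the `2 ^ (k + 1)` sets of buckets.  Hoeffding's inequality and a union bound
(`empirical_tv_tail`) make the estimate accurate to within `θ`, except with probability `δ' / 2`
(`outsideBucket_accurate`); here `δ' = δ / 2`.

*Close distributions.*  If `(1 - ε) P ≤ Q ≤ (1 + ε) P`, the bucket distributions are at distance at
most `ε / 2`, and for every pair the conditional probability of `p` under `Q` is at least the
threshold `h`.  By Hoeffding each pair test errs with probability at most `δ' / (4 m t)`
(`pairTest_accepts`), and at most `m` pairs are tested in each of the `t` rounds.

*Far distributions.*  Suppose that the estimate is accurate and let `B` be the `margin`, so that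
`ε₁ - α = B / 2.1` and `m = ⌈√k / (B / 21)⌉`.  A total variation distance above `η` that is not
visible in the bucket distributions lies inside the buckets: `P` and `Q` share a mass of at least
`B / 21` on the buckets whose conditional distributions are at distance at least `ε₁`
(`le_sum_min_farBuckets`).  By the birthday paradox, both sample lists hit a common bucket of this
kind with probability at least `1 / 5` (`listE_collision_ge`).  The first samples in it are an
independent pair from the conditional distributions (`listE_first`, `listE_bad_first`), and such a
pair has odds below the threshold `l` with probability at least `(ε₁ - α) / 2` (`bad_pairs`).  So
a round rejects with probability at least `B / 21`, up to an error `δ' / (4 m t)`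
(`insideRound_rejects`), and `t` is chosen such that `(1 - B / 21) ^ t ≤ δ' / 4`.

*Queries.*  When InsideBucket is reached, `B ≥ η / 3`, the thresholds of a pair in a common bucket
differ by at least `B / 105` (`threshold_gap`), and a round tests at most `m` pairs.  This makes
`O(t m log (m t / δ) / B²)`, that is `√n log n / η⁴` up to logarithmic factors, and
`η⁻⁴ ≤ η⁻³ (η - 11.6 ε)⁻¹`.
-/

namespace Barbarik

open OracleProg

/-! ### Expectation semantics of oracle programs -/

section Semantics

variable {n : ℕ} {α β : Type}

open Classical in
/-- The weights of `Q` conditioned on `{a, b}`; they all vanish if `{a, b}` has probability zero. -/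
noncomputable def condWeight (Q : PMF (Cube n)) (a b x : Cube n) : ℝ :=
  (if x = a ∨ x = b then (Q x).toReal else 0) / ((Q a).toReal + (Q b).toReal)

/-- The expectation of `g` of the output of a program; a failing run contributes `0`. -/
noncomputable def ev (P Q : PMF (Cube n)) : OracleProg n α → (α → ℝ) → ℝ
  | ret a, g => g a
  | sampP k, g => ∑ x, (P x).toReal * ev P Q (k x) g
  | evalP x k, g => ev P Q (k (P x).toReal) g
  | sampQ k, g => ∑ x, (Q x).toReal * ev P Q (k x) g
  | pcondQ a b _ k, g => ∑ x, condWeight Q a b x * ev P Q (k x) g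

theorem condWeight_nonneg (Q : PMF (Cube n)) (a b x : Cube n) : 0 ≤ condWeight Q a b x := by
  unfold condWeight
  split_ifs <;> positivity

theorem sum_toReal (P : PMF (Cube n)) : ∑ x, (P x).toReal = 1 := by
  rw [← ENNReal.toReal_sum (fun x _ => P.apply_ne_top x), ← tsum_fintype (L := .unconditional _),
    P.tsum_coe, ENNReal.toReal_one]

theorem sum_ite_pair {a b : Cube n} (hab : a ≠ b) (f : Cube n → ℝ) :
    ∑ x, (if x = a ∨ x = b then f x else 0) = f a + f b := by
  classical
  rw [← Finset.sum_filter, show Finset.univ.filter (fun x => x = a ∨ x = b) = {a, b} by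
    ext x; simp, Finset.sum_pair hab]

theorem sum_condWeight {Q : PMF (Cube n)} {a b : Cube n} (hab : a ≠ b) (hb : 0 < (Q b).toReal) :
    ∑ x, condWeight Q a b x = 1 := by
  have hpos : 0 < (Q a).toReal + (Q b).toReal := by positivity
  simp only [condWeight]
  rw [← Finset.sum_div]
  rw [show (∑ x, if x = a ∨ x = b then (Q x).toReal else 0) = (Q a).toReal + (Q b).toReal by
    convert sum_ite_pair hab (fun x => (Q x).toReal)]
  exact div_self hpos.ne'

theorem ev_pure (P Q : PMF (Cube n)) (a : α) (g : α → ℝ) :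
    ev P Q (pure a : OracleProg n α) g = g a := rfl

theorem ev_bind (P Q : PMF (Cube n)) (A : OracleProg n α) (f : α → OracleProg n β) (g : β → ℝ) :
    ev P Q (A >>= f) g = ev P Q A fun a => ev P Q (f a) g := by
  change ev P Q (A.bind f) g = _
  induction A with
  | ret a => rfl
  | sampP k ih => simp only [OracleProg.bind, ev, ih]
  | evalP x k ih => simp only [OracleProg.bind, ev, ih]
  | sampQ k ih => simp only [OracleProg.bind, ev, ih]
  | pcondQ a b h k ih => simp only [OracleProg.bind, ev, ih]

theorem ev_add (P Q : PMF (Cube n)) (A : OracleProg n α) (g h : α → ℝ) :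
    ev P Q A (fun a => g a + h a) = ev P Q A g + ev P Q A h := by
  induction A with
  | ret a => rfl
  | evalP x k ih => simp only [ev, ih]
  | _ => simp_all only [ev, mul_add, Finset.sum_add_distrib]

theorem ev_mul_const (P Q : PMF (Cube n)) (A : OracleProg n α) (g : α → ℝ) (c : ℝ) :
    ev P Q A (fun a => g a * c) = ev P Q A g * c := by
  induction A with
  | ret a => rfl
  | evalP x k ih => simp only [ev, ih]
  | _ => simp_all only [ev, ← mul_assoc, Finset.sum_mul]

theorem ev_mono (P Q : PMF (Cube n)) (A : OracleProg n α) {g h : α → ℝ} (hgh : ∀ a, g a ≤ h a) :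
    ev P Q A g ≤ ev P Q A h := by
  induction A with
  | ret a => exact hgh a
  | evalP x k ih => exact ih _
  | sampP k ih =>
    exact Finset.sum_le_sum fun x _ => mul_le_mul_of_nonneg_left (ih x) ENNReal.toReal_nonneg
  | sampQ k ih =>
    exact Finset.sum_le_sum fun x _ => mul_le_mul_of_nonneg_left (ih x) ENNReal.toReal_nonneg
  | pcondQ a b _ k ih =>
    exact Finset.sum_le_sum fun x _ => mul_le_mul_of_nonneg_left (ih x) (condWeight_nonneg ..)

theorem ev_nonneg (P Q : PMF (Cube n)) (A : OracleProg n α) {g : α → ℝ} (hg : ∀ a, 0 ≤ g a) :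
    0 ≤ ev P Q A g := by
  have h := ev_mono P Q A (g := fun _ => 0 * 0) (h := g) (by simpa using hg)
  rwa [ev_mul_const P Q A (fun _ => 0) 0, mul_zero] at h

theorem map_fst_map_tick (p : PMF (Option α × ℕ)) :
    (p.map tick).map Prod.fst = p.map Prod.fst := by
  rw [PMF.map_comp]; rfl

theorem toReal_bind_apply (p : PMF (Cube n)) (f : Cube n → PMF (Option α)) (o : Option α) :
    ((p.bind f) o).toReal = ∑ x, (p x).toReal * (f x o).toReal := by
  rw [PMF.bind_apply, tsum_fintype, ENNReal.toReal_sum]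
  · simp only [ENNReal.toReal_mul]
  · intro x _
    exact ENNReal.mul_ne_top (p.apply_ne_top x) ((f x).apply_ne_top o)

open Classical in
theorem toReal_filter_pair {Q : PMF (Cube n)} {a b : Cube n} (hab : a ≠ b)
    (h : ∃ x ∈ ({a, b} : Set (Cube n)), x ∈ Q.support) (x : Cube n) :
    (Q.filter {a, b} h x).toReal = condWeight Q a b x := by
  have hsum : ∑' y, ({a, b} : Set (Cube n)).indicator Q y = Q a + Q b := by
    rw [tsum_fintype]
    simp only [Set.indicator_apply, Set.mem_insert_iff, Set.mem_singleton_iff]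
    rw [← Finset.sum_filter, show Finset.univ.filter (fun x => x = a ∨ x = b) = {a, b} by
      ext x; simp, Finset.sum_pair hab]
  rw [PMF.filter_apply, hsum, ENNReal.toReal_mul, ENNReal.toReal_inv,
    ENNReal.toReal_add (Q.apply_ne_top a) (Q.apply_ne_top b), condWeight, div_eq_mul_inv]
  congr 1
  simp only [Set.indicator_apply, Set.mem_insert_iff, Set.mem_singleton_iff]
  split_ifs <;> simp

open Classical in
theorem toReal_probReturns (P Q : PMF (Cube n)) (A : OracleProg n α) (a : α) :
    (A.probReturns P Q a).toReal = ev P Q A fun b => if b = a then 1 else 0 := by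
  unfold probReturns
  induction A with
  | ret b =>
    simp only [run, ev, PMF.pure_map, PMF.pure_apply, Option.some.injEq]
    by_cases h : b = a
    · simp [h]
    · simp [h, Ne.symm h]
  | sampP k ih =>
    rw [run, map_fst_map_tick, PMF.map_bind, toReal_bind_apply]
    simp only [ih, ev]
  | evalP x k ih =>
    rw [run, map_fst_map_tick, ih, ev]
  | sampQ k ih =>
    rw [run, map_fst_map_tick, PMF.map_bind, toReal_bind_apply]
    simp only [ih, ev]
  | pcondQ b c hbc k ih =>
    rw [run]
    split_ifs with h
    · rw [map_fst_map_tick, PMF.map_bind, toReal_bind_apply]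
      simp only [ih, ev, toReal_filter_pair hbc h]
    · have h0 : ∀ x, condWeight Q b c x = 0 := by
        intro x
        simp only [Set.mem_insert_iff, Set.mem_singleton_iff, exists_eq_or_imp, exists_eq_left,
          PMF.mem_support_iff, not_or, not_not] at h
        simp [condWeight, h.1, h.2]
      simp [ev, h0, PMF.pure_map, PMF.pure_apply]

theorem ofReal_le_probReturns {P Q : PMF (Cube n)} {A : OracleProg n α} {a : α} {c : ℝ}
    {g : α → ℝ} (hg : ∀ b, b ≠ a → g b = 0) (hga : g a = 1) (h : c ≤ ev P Q A g) :
    ENNReal.ofReal c ≤ A.probReturns P Q a := by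
  classical
  have hg' : g = fun b => if b = a then 1 else 0 := by
    funext b
    by_cases hb : b = a
    · simp [hb, hga]
    · simp [hb, hg b hb]
  rw [hg', ← toReal_probReturns] at h
  exact (ENNReal.ofReal_le_ofReal h).trans ENNReal.ofReal_toReal_le

end Semantics

/-! ### Query bounds -/

section Queries

variable {n : ℕ} {α β : Type}

/-- Whatever the oracles answer, the program makes at most `b` queries and its output satisfies
`I`. -/
def QueryBound : OracleProg n α → ℕ → (α → Prop) → Prop
  | ret a, _, I => I a
  | sampP k, b, I => 1 ≤ b ∧ ∀ x, QueryBound (k x) (b - 1) I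
  | evalP _ k, b, I => 1 ≤ b ∧ ∀ w, QueryBound (k w) (b - 1) I
  | sampQ k, b, I => 1 ≤ b ∧ ∀ x, QueryBound (k x) (b - 1) I
  | pcondQ _ _ _ k, b, I => 1 ≤ b ∧ ∀ x, QueryBound (k x) (b - 1) I

theorem QueryBound.mono {A : OracleProg n α} {b b' : ℕ} {I J : α → Prop} (h : QueryBound A b I)
    (hb : b ≤ b') (hI : ∀ a, I a → J a) : QueryBound A b' J := by
  induction A generalizing b b' with
  | ret a => exact hI a h
  | _ =>
    rename_i ih
    exact ⟨h.1.trans hb, fun x => ih x (h.2 x) (Nat.sub_le_sub_right hb 1)⟩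

theorem QueryBound.bind {A : OracleProg n α} {f : α → OracleProg n β} {b c : ℕ} {I : α → Prop}
    {J : β → Prop} (h : QueryBound A b I) (hf : ∀ a, I a → QueryBound (f a) c J) :
    QueryBound (A >>= f) (b + c) J := by
  change QueryBound (A.bind f) (b + c) J
  induction A generalizing b with
  | ret a => exact (hf a h).mono (Nat.le_add_left _ _) fun _ h => h
  | _ =>
    rename_i ih
    refine ⟨le_add_right h.1, fun x => ?_⟩
    have := ih x (h.2 x)
    rwa [← Nat.sub_add_comm h.1] at this

theorem mem_support_map_tick {p : PMF (Option α × ℕ)} {b : ℕ} (hb : 1 ≤ b)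
    (h : ∀ o ∈ p.support, o.2 ≤ b - 1) : ∀ o ∈ (p.map tick).support, o.2 ≤ b := by
  intro o ho
  obtain ⟨o', ho', rfl⟩ := (PMF.mem_support_map_iff ..).1 ho
  have := h o' ho'
  simp only [tick]
  omega

theorem QueryBound.le_of_mem_support {A : OracleProg n α} {b : ℕ} {I : α → Prop}
    (h : QueryBound A b I) (P Q : PMF (Cube n)) : ∀ o ∈ (A.run P Q).support, o.2 ≤ b := by
  induction A generalizing b with
  | ret a =>
    intro o ho
    rw [run, PMF.mem_support_pure_iff] at ho
    simp [ho]
  | evalP x k ih =>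
    rw [run]
    exact mem_support_map_tick h.1 (ih _ (h.2 _))
  | sampP k ih =>
    rw [run]
    refine mem_support_map_tick h.1 fun o ho => ?_
    obtain ⟨x, -, hx⟩ := (PMF.mem_support_bind_iff ..).1 ho
    exact ih x (h.2 x) o hx
  | sampQ k ih =>
    rw [run]
    refine mem_support_map_tick h.1 fun o ho => ?_
    obtain ⟨x, -, hx⟩ := (PMF.mem_support_bind_iff ..).1 ho
    exact ih x (h.2 x) o hx
  | pcondQ a c hac k ih =>
    rw [run]
    split_ifs with hs
    · refine mem_support_map_tick h.1 fun o ho => ?_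
      obtain ⟨x, -, hx⟩ := (PMF.mem_support_bind_iff ..).1 ho
      exact ih x (h.2 x) o hx
    · intro o ho
      rw [PMF.mem_support_pure_iff] at ho
      simpa [ho] using h.1

theorem QueryBound.repeatN {A : OracleProg n α} {b : ℕ} {I : α → Prop} (h : QueryBound A b I)
    (N : ℕ) : QueryBound (OracleProg.repeatN A N) (N * b) fun l => l.length = N := by
  induction N with
  | zero => exact rfl
  | succ N ih =>
    rw [Nat.succ_mul, Nat.add_comm (N * b)]
    refine h.bind fun a _ => ih.bind (c := 0) fun l hl => ?_
    change (a :: l).length = N + 1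
    simp [hl]

theorem QueryBound.allAccept {test : β → OracleProg n Verdict} {cost : β → ℕ} {l : List β}
    (h : ∀ b ∈ l, QueryBound (test b) (cost b) fun _ => True) :
    QueryBound (OracleProg.allAccept test l) (l.map cost).sum fun _ => True := by
  induction l with
  | nil => trivial
  | cons b l ih =>
    rw [List.map_cons, List.sum_cons]
    refine (h b List.mem_cons_self).bind fun v _ => ?_
    cases v with
    | reject => trivial
    | accept => exact ih fun c hc => h c (List.mem_cons_of_mem _ hc)

end Queries

/-! ### Independent samples from a finite distribution -/

section ListE

variable {β : Type} [Fintype β]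

/-- The expectation of `g` of a list of `N` independent samples with weights `w`. -/
noncomputable def listE (w : β → ℝ) : ℕ → (List β → ℝ) → ℝ
  | 0, g => g []
  | N + 1, g => ∑ x, w x * listE w N fun l => g (x :: l)

theorem ev_repeatN {n : ℕ} {α : Type} {P Q : PMF (Cube n)} {A : OracleProg n α} {w : β → ℝ}
    {φ : β → α} (hA : ∀ g, ev P Q A g = ∑ x, w x * g (φ x)) (N : ℕ) (g : List α → ℝ) :
    ev P Q (repeatN A N) g = listE w N fun l => g (l.map φ) := by
  induction N generalizing g with
  | zero => rfl
  | succ N ih =>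
    rw [repeatN, ev_bind, hA, listE]
    refine Finset.sum_congr rfl fun x _ => ?_
    rw [ev_bind, ih]
    rfl

theorem listE_mono {w : β → ℝ} (hw : ∀ x, 0 ≤ w x) {N : ℕ} {g h : List β → ℝ}
    (hgh : ∀ l, l.length = N → (∀ x ∈ l, 0 < w x) → g l ≤ h l) : listE w N g ≤ listE w N h := by
  induction N generalizing g h with
  | zero => exact hgh [] rfl (by simp)
  | succ N ih =>
    refine Finset.sum_le_sum fun x _ => ?_
    rcases (hw x).eq_or_lt with hx | hx
    · simp [← hx]
    · refine mul_le_mul_of_nonneg_left (ih fun l hl hl' => hgh _ (by simp [hl]) ?_) hx.le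
      intro y hy
      rcases List.mem_cons.1 hy with rfl | hy
      exacts [hx, hl' y hy]

theorem listE_congr {w : β → ℝ} (hw : ∀ x, 0 ≤ w x) {N : ℕ} {g h : List β → ℝ}
    (hgh : ∀ l, l.length = N → (∀ x ∈ l, 0 < w x) → g l = h l) : listE w N g = listE w N h :=
  le_antisymm (listE_mono hw fun l h₁ h₂ => (hgh l h₁ h₂).le)
    (listE_mono hw fun l h₁ h₂ => (hgh l h₁ h₂).ge)

theorem listE_add (w : β → ℝ) (N : ℕ) (g h : List β → ℝ) :
    listE w N (fun l => g l + h l) = listE w N g + listE w N h := by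
  induction N generalizing g h with
  | zero => rfl
  | succ N ih => simp only [listE, ih, mul_add, Finset.sum_add_distrib]

theorem listE_const_mul (w : β → ℝ) (N : ℕ) (c : ℝ) (g : List β → ℝ) :
    listE w N (fun l => c * g l) = c * listE w N g := by
  induction N generalizing g with
  | zero => rfl
  | succ N ih => simp only [listE, ih, Finset.mul_sum, mul_left_comm]

theorem listE_sum {ι : Type} (w : β → ℝ) (N : ℕ) (s : Finset ι) (g : ι → List β → ℝ) :
    listE w N (fun l => ∑ i ∈ s, g i l) = ∑ i ∈ s, listE w N (g i) := by
  classical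
  induction s using Finset.induction_on with
  | empty => simpa using listE_const_mul w N 0 fun _ => 0
  | insert a s ha ih => simp only [Finset.sum_insert ha, listE_add, ih]

theorem listE_prod (w : β → ℝ) (N : ℕ) (f : β → ℝ) :
    listE w N (fun l => (l.map f).prod) = (∑ x, w x * f x) ^ N := by
  induction N with
  | zero => simp [listE]
  | succ N ih =>
    simp only [listE, List.map_cons, List.prod_cons, listE_const_mul, ih, pow_succ',
      Finset.sum_mul, mul_assoc]

theorem listE_const {w : β → ℝ} (hw1 : ∑ x, w x = 1) (N : ℕ) (c : ℝ) :
    listE w N (fun _ => c) = c := by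
  have h := listE_prod w N fun _ => 1
  simp only [List.map_const', List.prod_replicate, one_pow, mul_one, hw1] at h
  simpa [h] using listE_const_mul w N c fun _ => 1

theorem listE_nonneg {w : β → ℝ} (hw : ∀ x, 0 ≤ w x) (N : ℕ) {g : List β → ℝ}
    (hg : ∀ l, 0 ≤ g l) : 0 ≤ listE w N g := by
  have h : listE w N (fun l => 0 * g l) ≤ listE w N g :=
    listE_mono hw fun l _ _ => by simpa using hg l
  rwa [listE_const_mul, zero_mul] at h

/-! ### Concentration -/

open MeasureTheory ProbabilityTheory in
/-- Hoeffding's lemma for a finite distribution and a function with values in `[0, 1]`. -/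
theorem sum_mul_exp_le {w : β → ℝ} (hw : ∀ x, 0 ≤ w x) (hw1 : ∑ x, w x = 1) {f : β → ℝ}
    (hf : ∀ x, f x ∈ Set.Icc (0 : ℝ) 1) (t : ℝ) :
    ∑ x, w x * Real.exp (t * f x) ≤ Real.exp (t * (∑ x, w x * f x) + t ^ 2 / 8) := by
  classical
  let _ : MeasurableSpace β := ⊤
  have : MeasurableSingletonClass β := ⟨fun _ => trivial⟩
  let p : PMF β := PMF.ofFintype (fun x => ENNReal.ofReal (w x)) (by
    rw [← ENNReal.ofReal_sum_of_nonneg fun x _ => hw x, hw1, ENNReal.ofReal_one])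
  have hint : ∀ F : β → ℝ, ∫ x, F x ∂p.toMeasure = ∑ x, w x * F x := by
    intro F
    rw [PMF.integral_eq_sum]
    refine Finset.sum_congr rfl fun x _ => ?_
    simp [p, ENNReal.toReal_ofReal (hw x)]
  have h := (hasSubgaussianMGF_of_mem_Icc (μ := p.toMeasure) (X := f) (a := 0) (b := 1)
    (Measurable.of_discrete).aemeasurable (Filter.Eventually.of_forall hf)).mgf_le t
  rw [mgf, hint, hint] at h
  have hc : ((‖(1 : ℝ) - 0‖₊ / 2) ^ 2 : NNReal) * t ^ 2 / 2 = t ^ 2 / 8 := by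
    simp; ring
  rw [hc] at h
  calc ∑ x, w x * Real.exp (t * f x)
      = Real.exp (t * ∑ x, w x * f x) *
          ∑ x, w x * Real.exp (t * (f x - ∑ x, w x * f x)) := by
        rw [Finset.mul_sum]
        refine Finset.sum_congr rfl fun x _ => ?_
        rw [mul_left_comm, ← Real.exp_add]
        ring_nf
    _ ≤ _ := by
        rw [Real.exp_add]
        exact mul_le_mul_of_nonneg_left h (Real.exp_pos _).le

theorem prod_map_exp {γ : Type} (l : List γ) (f : γ → ℝ) (t : ℝ) :
    (l.map fun x => Real.exp (t * f x)).prod = Real.exp (t * (l.map f).sum) := by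
  induction l with
  | nil => simp
  | cons x l ih => simp [ih, mul_add, Real.exp_add]

theorem sum_map_one_sub {γ : Type} (l : List γ) (f : γ → ℝ) :
    (l.map fun x => 1 - f x).sum = l.length - (l.map f).sum := by
  induction l with
  | nil => simp
  | cons x l ih =>
    simp only [List.map_cons, List.sum_cons, ih, List.length_cons]
    push_cast
    ring

open Classical in
/-- Hoeffding's inequality, upper tail. -/
theorem hoeffding_upper {w : β → ℝ} (hw : ∀ x, 0 ≤ w x) (hw1 : ∑ x, w x = 1) {f : β → ℝ}
    (hf : ∀ x, f x ∈ Set.Icc (0 : ℝ) 1) (N : ℕ) {s : ℝ} (hs : 0 ≤ s) :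
    listE w N (fun l => if N * ((∑ x, w x * f x) + s) ≤ (l.map f).sum then 1 else 0) ≤
      Real.exp (-(2 * N * s ^ 2)) := by
  set p := ∑ x, w x * f x with hp
  have h1 : listE w N (fun l => if N * (p + s) ≤ (l.map f).sum then 1 else 0) ≤
      listE w N (fun l => Real.exp (-(4 * s * (N * (p + s)))) *
        (l.map fun x => Real.exp (4 * s * f x)).prod) := by
    refine listE_mono hw fun l _ _ => ?_
    rw [prod_map_exp, ← Real.exp_add]
    split_ifs with h
    · rw [Real.one_le_exp_iff]
      have := mul_le_mul_of_nonneg_left h (show 0 ≤ 4 * s by positivity)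
      linarith
    · exact (Real.exp_pos _).le
  refine h1.trans ?_
  rw [listE_const_mul, listE_prod]
  have h2 := pow_le_pow_left₀ (Finset.sum_nonneg fun x _ =>
    mul_nonneg (hw x) (Real.exp_pos _).le) (sum_mul_exp_le hw hw1 hf (4 * s)) N
  refine (mul_le_mul_of_nonneg_left h2 (Real.exp_pos _).le).trans ?_
  rw [← Real.exp_nat_mul, ← Real.exp_add, ← hp]
  apply le_of_eq
  congr 1
  ring

open Classical in
/-- Hoeffding's inequality, lower tail. -/
theorem hoeffding_lower {w : β → ℝ} (hw : ∀ x, 0 ≤ w x) (hw1 : ∑ x, w x = 1) {f : β → ℝ}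
    (hf : ∀ x, f x ∈ Set.Icc (0 : ℝ) 1) (N : ℕ) {s : ℝ} (hs : 0 ≤ s) :
    listE w N (fun l => if (l.map f).sum ≤ N * ((∑ x, w x * f x) - s) then 1 else 0) ≤
      Real.exp (-(2 * N * s ^ 2)) := by
  have h := hoeffding_upper hw hw1 (f := fun x => 1 - f x)
    (fun x => ⟨by linarith [(hf x).2], by linarith [(hf x).1]⟩) N hs
  refine le_trans (listE_mono hw fun l hl _ => ?_) h
  have h1 : (l.map fun x => 1 - f x).sum = N - (l.map f).sum := by
    rw [sum_map_one_sub, hl]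
  have h2 : ∑ x, w x * (1 - f x) = 1 - ∑ x, w x * f x := by
    simp only [mul_sub, mul_one, Finset.sum_sub_distrib, hw1]
  simp only [h1, h2]
  split_ifs with h3 h4 h4
  · exact le_rfl
  · exact absurd (by linarith) h4
  · exact zero_le_one
  · exact le_rfl

/-! ### The empirical total variation distance -/

/-- The weight of the label `i` under `w`. -/
noncomputable def labelWeight (w : β → ℝ) (φ : β → ℕ) (i : ℕ) : ℝ :=
  ∑ x, if φ x = i then w x else 0

theorem labelWeight_nonneg {w : β → ℝ} (hw : ∀ x, 0 ≤ w x) (φ : β → ℕ) (i : ℕ) :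
    0 ≤ labelWeight w φ i :=
  Finset.sum_nonneg fun x _ => by split_ifs <;> simp [hw x]

theorem sum_labelWeight (w : β → ℝ) (φ : β → ℕ) (A : Finset ℕ) :
    ∑ i ∈ A, labelWeight w φ i = ∑ x, w x * if φ x ∈ A then 1 else 0 := by
  simp only [labelWeight]
  rw [Finset.sum_comm]
  refine Finset.sum_congr rfl fun x _ => ?_
  rw [Finset.sum_ite_eq]
  split_ifs <;> simp

theorem sum_range_labelWeight {w : β → ℝ} (hw1 : ∑ x, w x = 1) {φ : β → ℕ} {k : ℕ}
    (hφ : ∀ x, φ x ≤ k) : ∑ i ∈ Finset.range (k + 1), labelWeight w φ i = 1 := by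
  rw [sum_labelWeight]
  refine (Finset.sum_congr rfl fun x _ => ?_).trans hw1
  rw [if_pos (Finset.mem_range.2 (Nat.lt_succ_of_le (hφ x))), mul_one]

theorem sum_count_map {γ : Type} (φ : γ → ℕ) (A : Finset ℕ) (l : List γ) :
    ∑ i ∈ A, ((l.map φ).count i : ℝ) = (l.map fun x => if φ x ∈ A then (1 : ℝ) else 0).sum := by
  induction l with
  | nil => simp
  | cons x l ih =>
    simp only [List.map_cons, List.count_cons, List.sum_cons, Nat.cast_add, Finset.sum_add_distrib,
      ih, beq_iff_eq]
    rw [add_comm]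
    congr 1
    simp [Finset.sum_ite_eq]

/-- For two functions with the same sum, half the `ℓ¹` distance is the largest excess of the one
over the other on a set. -/
theorem exists_half_sum_abs_eq {ι : Type} (s : Finset ι) (u v : ι → ℝ)
    (h : ∑ i ∈ s, u i = ∑ i ∈ s, v i) :
    ∃ A ⊆ s, (1 / 2) * ∑ i ∈ s, |u i - v i| = ∑ i ∈ A, u i - ∑ i ∈ A, v i := by
  classical
  refine ⟨s.filter fun i => v i ≤ u i, Finset.filter_subset _ _, ?_⟩
  have h1 : ∑ i ∈ s, |u i - v i| =
      ∑ i ∈ s, (2 * (if v i ≤ u i then u i - v i else 0) - (u i - v i)) := by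
    refine Finset.sum_congr rfl fun i _ => ?_
    split_ifs with hi
    · rw [abs_of_nonneg (by linarith)]; ring
    · rw [abs_of_nonpos (by linarith)]; ring
  rw [h1, Finset.sum_sub_distrib, ← Finset.mul_sum, ← Finset.sum_filter]
  simp only [Finset.sum_sub_distrib, h]
  ring

open Classical in
/-- The empirical distribution of `N` samples on `{0, …, k}` is close to the true one in total
variation: a union bound over the `2 ^ (k + 1)` events. -/
theorem empirical_tv_tail {w : β → ℝ} (hw : ∀ x, 0 ≤ w x) (hw1 : ∑ x, w x = 1) {φ : β → ℕ}
    {k N : ℕ} (hφ : ∀ x, φ x ≤ k) (hN : 0 < N) {s : ℝ} (hs : 0 ≤ s) :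
    listE w N (fun l => if s < (1 / 2) * ∑ i ∈ Finset.range (k + 1),
      |((l.map φ).count i : ℝ) / N - labelWeight w φ i| then 1 else 0) ≤
      2 ^ (k + 1) * Real.exp (-(2 * N * s ^ 2)) := by
  have hN' : (0 : ℝ) < N := Nat.cast_pos.2 hN
  let f : Finset ℕ → β → ℝ := fun A x => if φ x ∈ A then 1 else 0
  have h1 : listE w N (fun l => if s < (1 / 2) * ∑ i ∈ Finset.range (k + 1),
      |((l.map φ).count i : ℝ) / N - labelWeight w φ i| then 1 else 0) ≤
      listE w N (fun l => ∑ A ∈ (Finset.range (k + 1)).powerset,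
        if N * ((∑ x, w x * f A x) + s) ≤ (l.map (f A)).sum then 1 else 0) := by
    refine listE_mono hw fun l hl _ => ?_
    have hnn : ∀ A ∈ (Finset.range (k + 1)).powerset,
        (0 : ℝ) ≤ if N * ((∑ x, w x * f A x) + s) ≤ (l.map (f A)).sum then 1 else 0 :=
      fun A _ => by split_ifs <;> norm_num
    split_ifs with h
    · have hsum : ∑ i ∈ Finset.range (k + 1), ((l.map φ).count i : ℝ) / N =
          ∑ i ∈ Finset.range (k + 1), labelWeight w φ i := by
        rw [← Finset.sum_div, sum_count_map, sum_range_labelWeight hw1 hφ]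
        have : (l.map fun x => if φ x ∈ Finset.range (k + 1) then (1 : ℝ) else 0) =
            l.map fun _ => 1 := by
          refine List.map_congr_left fun x _ => ?_
          rw [if_pos (Finset.mem_range.2 (Nat.lt_succ_of_le (hφ x)))]
        rw [this]
        simp [hl, hN'.ne']
      obtain ⟨A, hA, hAeq⟩ := exists_half_sum_abs_eq _ _ _ hsum
      refine le_trans ?_ (Finset.single_le_sum hnn (Finset.mem_powerset.2 hA))
      rw [hAeq, ← Finset.sum_div, sum_count_map, sum_labelWeight, lt_sub_iff_add_lt,
        lt_div_iff₀ hN'] at h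
      rw [if_pos]
      simp only [f]
      linarith
    · exact Finset.sum_nonneg hnn
  refine h1.trans ?_
  rw [listE_sum]
  refine (Finset.sum_le_card_nsmul _ _ (Real.exp (-(2 * N * s ^ 2))) fun A _ => ?_).trans ?_
  · refine hoeffding_upper hw hw1 (fun x => ?_) N hs
    simp only [f]
    split_ifs <;> simp
  · simp [Finset.card_powerset]

end ListE

/-! ### Buckets -/

section Buckets

theorem bucketIndex_le (k : ℕ) (w : ℝ) : bucketIndex k w ≤ k := by
  unfold bucketIndex
  split_ifs with h
  · exact (Nat.find_spec h).2.1
  · exact Nat.zero_le k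

theorem bucketIndex_spec {k j : ℕ} {w : ℝ} (h : bucketIndex k w = j) (hj : 1 ≤ j) :
    (2 : ℝ) ^ (-(j : ℤ)) < w ∧ w ≤ (2 : ℝ) ^ (-(j : ℤ) + 1) := by
  unfold bucketIndex at h
  split_ifs at h with h'
  · have := (Nat.find_spec h').2.2
    rwa [h] at this
  · omega

theorem pos_of_bucketIndex {k j : ℕ} {w : ℝ} (h : bucketIndex k w = j) (hj : 1 ≤ j) : 0 < w :=
  lt_trans (by positivity) (bucketIndex_spec h hj).1

theorem le_two_mul_of_bucketIndex {k j : ℕ} {v w : ℝ} (hv : bucketIndex k v = j)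
    (hw : bucketIndex k w = j) (hj : 1 ≤ j) : v ≤ 2 * w := by
  have h1 := (bucketIndex_spec hv hj).2
  have h2 := (bucketIndex_spec hw hj).1
  rw [zpow_add₀ two_ne_zero, zpow_one] at h1
  linarith

theorem le_of_bucketIndex_eq_zero {k : ℕ} {w : ℝ} (hw : w ≤ 1) (h : bucketIndex k w = 0) :
    w ≤ ((2 : ℝ) ^ k)⁻¹ := by
  by_contra! hlt
  have hex : ∃ i : ℕ, ((2 : ℝ) ^ i)⁻¹ < w := ⟨k, hlt⟩
  classical
  have hi := Nat.find_spec hex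
  set i := Nat.find hex with hidef
  have hik : i ≤ k := Nat.find_min' hex hlt
  have hi1 : 1 ≤ i := by
    by_contra! h0
    rw [Nat.lt_one_iff.1 h0] at hi
    norm_num at hi
    linarith
  have hprev : w ≤ ((2 : ℝ) ^ (i - 1))⁻¹ := not_lt.1 (Nat.find_min hex (by omega))
  have hexb : ∃ i : ℕ, 1 ≤ i ∧ i ≤ k ∧ (2 : ℝ) ^ (-(i : ℤ)) < w ∧
      w ≤ (2 : ℝ) ^ (-(i : ℤ) + 1) := by
    refine ⟨i, hi1, hik, by simpa using hi, ?_⟩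
    rw [show (-(i : ℤ) + 1) = -((i - 1 : ℕ) : ℤ) by omega]
    simpa using hprev
  unfold bucketIndex at h
  rw [dif_pos hexb] at h
  have := (Nat.find_spec hexb).1
  omega

variable {n : ℕ}

/-- The index of the bucket of `P` in which `x` lies. -/
noncomputable def label (k : ℕ) (P : PMF (Cube n)) (x : Cube n) : ℕ :=
  bucketIndex k (P x).toReal

/-- The probability of `x` as a real number. -/
noncomputable def wt (P : PMF (Cube n)) (x : Cube n) : ℝ := (P x).toReal

theorem wt_nonneg (P : PMF (Cube n)) (x : Cube n) : 0 ≤ wt P x := ENNReal.toReal_nonneg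

theorem sum_wt (P : PMF (Cube n)) : ∑ x, wt P x = 1 := sum_toReal P

theorem wt_le_one (P : PMF (Cube n)) (x : Cube n) : wt P x ≤ 1 :=
  ENNReal.toReal_le_of_le_ofReal zero_le_one (by simpa using P.coe_le_one x)

theorem labelWeight_zero_le {k : ℕ} {η : ℝ} (P : PMF (Cube n)) (hη : 0 < η)
    (hk : k = n + ⌈Real.logb 2 (100 / η)⌉₊) :
    labelWeight (wt P) (label k P) 0 ≤ η / 100 := by
  have h1 : labelWeight (wt P) (label k P) 0 ≤ ∑ _x : Cube n, ((2 : ℝ) ^ k)⁻¹ := by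
    refine Finset.sum_le_sum fun x _ => ?_
    split_ifs with h
    · exact le_of_bucketIndex_eq_zero (wt_le_one P x) h
    · positivity
  refine h1.trans ?_
  have h2 : 100 / η ≤ (2 : ℝ) ^ ⌈Real.logb 2 (100 / η)⌉₊ := by
    rw [← Real.rpow_natCast, ← Real.logb_le_iff_le_rpow one_lt_two (by positivity)]
    exact Nat.le_ceil _
  have h3 : ((2 : ℝ) ^ ⌈Real.logb 2 (100 / η)⌉₊)⁻¹ ≤ η / 100 := by
    rw [show η / 100 = (100 / η)⁻¹ by rw [inv_div]]
    exact inv_anti₀ (by positivity) h2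
  have h4 : ∑ _x : Cube n, ((2 : ℝ) ^ k)⁻¹ = ((2 : ℝ) ^ ⌈Real.logb 2 (100 / η)⌉₊)⁻¹ := by
    simp only [Finset.sum_const, Finset.card_univ, Fintype.card_fun, Fintype.card_bool,
      Fintype.card_fin, nsmul_eq_mul, hk, pow_add]
    push_cast
    field_simp
  rw [h4]
  exact h3

theorem ev_drawP (P Q : PMF (Cube n)) (g : Cube n × ℝ → ℝ) :
    ev P Q (drawP n) g = ∑ x, wt P x * g (x, wt P x) := rfl

theorem ev_drawQ (P Q : PMF (Cube n)) (g : Cube n × ℝ → ℝ) :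
    ev P Q (drawQ n) g = ∑ x, wt Q x * g (x, wt P x) := rfl

theorem ev_sampBP (k : ℕ) (P Q : PMF (Cube n)) (g : ℕ → ℝ) :
    ev P Q (sampBP n k) g = ∑ x, wt P x * g (label k P x) := rfl

theorem ev_sampBQ (k : ℕ) (P Q : PMF (Cube n)) (g : ℕ → ℝ) :
    ev P Q (sampBQ n k) g = ∑ x, wt Q x * g (label k P x) := rfl

/-- The total variation distance of the bucket distributions of `P` and `Q`. -/
noncomputable def bucketTV (k : ℕ) (P Q : PMF (Cube n)) : ℝ :=
  (1 / 2) * ∑ i ∈ Finset.range (k + 1),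
    |labelWeight (wt P) (label k P) i - labelWeight (wt Q) (label k P) i|

theorem abs_empiricalTV_sub_le (k N : ℕ) (s t : List ℕ) (p q : ℕ → ℝ) :
    |empiricalTV k N s t - (1 / 2) * (∑ i ∈ Finset.range (k + 1), |p i - q i|)| ≤
      (1 / 2) * ∑ i ∈ Finset.range (k + 1), |(s.count i : ℝ) / N - p i| +
        (1 / 2) * ∑ i ∈ Finset.range (k + 1), |(t.count i : ℝ) / N - q i| := by
  rw [empiricalTV, ← mul_sub, ← Finset.sum_sub_distrib, abs_mul, abs_of_nonneg one_half_pos.le,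
    ← mul_add, ← Finset.sum_add_distrib]
  refine mul_le_mul_of_nonneg_left ?_ one_half_pos.le
  refine (Finset.abs_sum_le_sum_abs _ _).trans (Finset.sum_le_sum fun i _ => ?_)
  refine (abs_abs_sub_abs_le_abs_sub _ _).trans ?_
  rw [show (s.count i : ℝ) / N - t.count i / N - (p i - q i) =
    (s.count i / N - p i) - (t.count i / N - q i) by ring]
  exact abs_sub _ _

theorem ev_outsideBucket (k : ℕ) (θ δ : ℝ) (P Q : PMF (Cube n)) :
    ∃ N : ℕ, 4 * ((k : ℝ) + 1) / θ ^ 2 ≤ N ∧ 8 * Real.log (4 / δ) / θ ^ 2 ≤ N ∧ ∀ g : ℝ → ℝ,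
      ev P Q (outsideBucket (sampBP n k) (sampBQ n k) k θ δ) g =
        listE (wt P) N fun s => listE (wt Q) N fun t =>
          g (empiricalTV k N (s.map (label k P)) (t.map (label k P))) := by
  refine ⟨⌈max (4 * ((k : ℝ) + 1) / θ ^ 2) (8 * Real.log (4 / δ) / θ ^ 2)⌉₊,
    (le_max_left _ _).trans (Nat.le_ceil _), (le_max_right _ _).trans (Nat.le_ceil _), fun g => ?_⟩
  unfold outsideBucket
  simp only [ev_bind, ev_pure]
  rw [ev_repeatN (ev_sampBP k P Q)]
  congr 1
  funext s
  rw [ev_repeatN (ev_sampBQ k P Q)]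

theorem ev_outsideBucket_const (k : ℕ) (θ δ : ℝ) (P Q : PMF (Cube n)) (c : ℝ) :
    ev P Q (outsideBucket (sampBP n k) (sampBQ n k) k θ δ) (fun _ => c) = c := by
  obtain ⟨N, -, -, h⟩ := ev_outsideBucket k θ δ P Q
  rw [h, listE_const (sum_wt Q), listE_const (sum_wt P)]

open Classical in
/-- OutsideBucket is accurate to within `θ`, except with probability `δ / 2`. -/
theorem outsideBucket_accurate (k : ℕ) {θ δ : ℝ} (hθ : 0 < θ) (hδ : 0 < δ) (hδ1 : δ ≤ 1)
    (P Q : PMF (Cube n)) :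
    ev P Q (outsideBucket (sampBP n k) (sampBQ n k) k θ δ)
      (fun d => if θ < |d - bucketTV k P Q| then 1 else 0) ≤ δ / 2 := by
  obtain ⟨N, hN1, hN2, h⟩ := ev_outsideBucket k θ δ P Q
  rw [h]
  have hNpos : 0 < N := by
    have : 0 < 4 * ((k : ℝ) + 1) / θ ^ 2 := by positivity
    exact_mod_cast this.trans_le hN1
  have hφ : ∀ x, label k P x ≤ k := fun x => bucketIndex_le _ _
  let T : (Cube n → ℝ) → List (Cube n) → ℝ := fun w l =>
    if θ / 2 < (1 / 2) * ∑ i ∈ Finset.range (k + 1),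
      |((l.map (label k P)).count i : ℝ) / N - labelWeight w (label k P) i| then 1 else 0
  have hT : ∀ w l, 0 ≤ T w l := fun w l => by simp only [T]; split_ifs <;> norm_num
  have hT1 : ∀ R : PMF (Cube n), listE (wt R) N (T (wt R)) ≤ δ / 4 := by
    intro R
    refine (empirical_tv_tail (wt_nonneg R) (sum_wt R) hφ hNpos (half_pos hθ).le).trans ?_
    have hθ2 : 0 < θ ^ 2 := by positivity
    rw [div_le_iff₀ hθ2] at hN1 hN2
    have hL : 0 ≤ Real.log (4 / δ) := Real.log_nonneg (by rw [le_div_iff₀ hδ]; linarith)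
    -- `N θ² / 2 ≥ (k + 1) + log (4 / δ)`, where `k + 1` pays for the `2 ^ (k + 1)` events.
    have hexp : Real.exp (-(2 * N * (θ / 2) ^ 2)) ≤
        Real.exp (-((k : ℝ) + 1)) * Real.exp (-Real.log (4 / δ)) := by
      rw [← Real.exp_add, Real.exp_le_exp]
      nlinarith
    have h2 : (2 : ℝ) ^ (k + 1) ≤ Real.exp ((k : ℝ) + 1) := by
      have : (2 : ℝ) ≤ Real.exp 1 := by linarith [Real.add_one_le_exp (1 : ℝ)]
      calc (2 : ℝ) ^ (k + 1) ≤ Real.exp 1 ^ (k + 1) := pow_le_pow_left₀ zero_le_two this _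
        _ = _ := by rw [← Real.exp_nat_mul]; push_cast; ring_nf
    calc _ ≤ Real.exp ((k : ℝ) + 1) *
          (Real.exp (-((k : ℝ) + 1)) * Real.exp (-Real.log (4 / δ))) := by gcongr
      _ = δ / 4 := by
        rw [← mul_assoc, ← Real.exp_add, add_neg_cancel, Real.exp_zero, one_mul, Real.exp_neg,
          Real.exp_log (by positivity), inv_div]
  calc _ ≤ listE (wt P) N fun s => listE (wt Q) N fun t => T (wt P) s + T (wt Q) t := by
        refine listE_mono (wt_nonneg P) fun s _ _ => listE_mono (wt_nonneg Q) fun t _ _ => ?_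
        split_ifs with hd
        · have := abs_empiricalTV_sub_le k N (s.map (label k P)) (t.map (label k P))
            (labelWeight (wt P) (label k P)) (labelWeight (wt Q) (label k P))
          have hd' := hd.trans_le this
          by_cases hs : θ / 2 < (1 / 2) * ∑ i ∈ Finset.range (k + 1),
            |((s.map (label k P)).count i : ℝ) / N - labelWeight (wt P) (label k P) i|
          · have : T (wt P) s = 1 := if_pos hs
            linarith [hT (wt Q) t]
          · have : T (wt Q) t = 1 := if_pos (by linarith)
            linarith [hT (wt P) s]
        · exact add_nonneg (hT _ _) (hT _ _)
    _ = listE (wt P) N (T (wt P)) + listE (wt Q) N (T (wt Q)) := by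
        simp only [listE_add, listE_const (sum_wt Q), listE_const (sum_wt P)]
    _ ≤ δ / 2 := by linarith [hT1 P, hT1 Q]

end Buckets

/-! ### Collisions of two sample lists -/

section Collisions

variable {β : Type} [Fintype β]

theorem prod_map_ite_not_mem {γ : Type} (l : List γ) (φ : γ → ℕ) (A : Finset ℕ) :
    (l.map fun x => if φ x ∈ A then (0 : ℝ) else 1).prod =
      if ∀ j ∈ A, j ∉ l.map φ then 1 else 0 := by
  induction l with
  | nil => simp
  | cons x l ih =>
    rw [List.map_cons, List.prod_cons, ih]
    by_cases hx : φ x ∈ A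
    · rw [if_pos hx, zero_mul, if_neg]
      intro h
      exact h _ hx (by simp)
    · rw [if_neg hx, one_mul]
      congr 1
      refine propext (forall₂_congr fun j hj => ?_)
      have : j ≠ φ x := fun h => hx (h ▸ hj)
      simp [this]

/-- The probability that no sample has a label in `A`, compared with Poisson samples. -/
theorem listE_avoid_le {w : β → ℝ} (hw : ∀ x, 0 ≤ w x) (hw1 : ∑ x, w x = 1) (φ : β → ℕ) (N : ℕ)
    (A : Finset ℕ) :
    listE w N (fun l => if ∀ j ∈ A, j ∉ l.map φ then 1 else 0) ≤
      ∏ j ∈ A, Real.exp (-(N * labelWeight w φ j)) := by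
  simp only [← prod_map_ite_not_mem]
  rw [listE_prod, ← Real.exp_sum, Finset.sum_neg_distrib, ← Finset.mul_sum, ← mul_neg,
    Real.exp_nat_mul]
  have h : ∑ x, w x * (if φ x ∈ A then (0 : ℝ) else 1) = 1 - ∑ j ∈ A, labelWeight w φ j := by
    rw [sum_labelWeight, eq_sub_iff_add_eq, ← Finset.sum_add_distrib]
    refine (Finset.sum_congr rfl fun x _ => ?_).trans hw1
    split_ifs <;> ring
  rw [h]
  refine pow_le_pow_left₀ ?_ ?_ N
  · rw [← h]
    exact Finset.sum_nonneg fun x _ => mul_nonneg (hw x) (by split_ifs <;> norm_num)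
  · linarith [Real.add_one_le_exp (-∑ j ∈ A, labelWeight w φ j)]

/-- The probability that two sample lists have no label of `G` in common is at most what it would
be if all labels occurred independently, as for a Poisson number of samples.  Given the first
list, the second avoids its labels with probability at most the product of the
`c j = exp (-N w_j)` over the labels `j` hit, where `w_j` is the weight of `j` under `w`;
expanding this product reduces the expectation over the first list to avoidance probabilities. -/
theorem listE_no_collision_le {v w : β → ℝ} (hv : ∀ x, 0 ≤ v x) (hv1 : ∑ x, v x = 1)
    (hw : ∀ x, 0 ≤ w x) (hw1 : ∑ x, w x = 1) (φ : β → ℕ) (N : ℕ) (G : Finset ℕ) :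
    listE v N (fun s => listE w N fun t =>
      if ∃ j ∈ G, j ∈ s.map φ ∧ j ∈ t.map φ then 0 else 1) ≤
      ∏ j ∈ G, (1 - (1 - Real.exp (-(N * labelWeight v φ j))) *
        (1 - Real.exp (-(N * labelWeight w φ j)))) := by
  classical
  set c : ℕ → ℝ := fun j => Real.exp (-(N * labelWeight w φ j)) with hc
  have hc1 : ∀ j, 0 ≤ 1 - c j := by
    intro j
    have : c j ≤ 1 := Real.exp_le_one_iff.2
      (neg_nonpos.2 (mul_nonneg N.cast_nonneg (labelWeight_nonneg hw φ j)))
    linarith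
  have hc0 : ∀ j, 0 ≤ c j := fun j => (Real.exp_pos _).le
  have h1 : ∀ s : List β, listE w N (fun t =>
      if ∃ j ∈ G, j ∈ s.map φ ∧ j ∈ t.map φ then 0 else 1) ≤
      ∑ A ∈ G.powerset, ((∏ j ∈ A, (1 - c j)) * ∏ j ∈ G \ A, c j) *
        if ∀ j ∈ A, j ∉ s.map φ then 1 else 0 := by
    intro s
    have h2 : listE w N (fun t => if ∃ j ∈ G, j ∈ s.map φ ∧ j ∈ t.map φ then 0 else 1) ≤
        ∏ j ∈ G.filter (fun j => j ∈ s.map φ), c j := by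
      refine le_trans (le_of_eq ?_) (listE_avoid_le hw hw1 φ N (G.filter fun j => j ∈ s.map φ))
      congr 1
      funext t
      by_cases h : ∃ j ∈ G, j ∈ s.map φ ∧ j ∈ t.map φ
      · rw [if_pos h, if_neg]
        intro h'
        obtain ⟨j, hj, hjs, hjt⟩ := h
        exact h' j (Finset.mem_filter.2 ⟨hj, hjs⟩) hjt
      · rw [if_neg h, if_pos]
        intro j hj hjt
        exact h ⟨j, (Finset.mem_filter.1 hj).1, (Finset.mem_filter.1 hj).2, hjt⟩
    refine h2.trans (le_of_eq ?_)
    -- In this form `Finset.prod_add` expands the product into avoidance events.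
    have h3 : ∏ j ∈ G.filter (fun j => j ∈ s.map φ), c j =
        ∏ j ∈ G, ((1 - c j) * (if j ∈ s.map φ then 0 else 1) + c j) := by
      rw [Finset.prod_filter]
      refine Finset.prod_congr rfl fun j _ => ?_
      split_ifs <;> ring
    rw [h3, Finset.prod_add]
    refine Finset.sum_congr rfl fun A _ => ?_
    rw [Finset.prod_mul_distrib, mul_right_comm]
    congr 1
    by_cases h : ∀ j ∈ A, j ∉ s.map φ
    · rw [if_pos h]
      exact Finset.prod_eq_one fun j hj => if_neg (h j hj)
    · rw [if_neg h]
      push Not at h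
      obtain ⟨j, hj, hjs⟩ := h
      exact Finset.prod_eq_zero hj (if_pos hjs)
  calc _ ≤ listE v N (fun s => ∑ A ∈ G.powerset, ((∏ j ∈ A, (1 - c j)) * ∏ j ∈ G \ A, c j) *
        if ∀ j ∈ A, j ∉ s.map φ then 1 else 0) := listE_mono hv fun s _ _ => h1 s
    _ = ∑ A ∈ G.powerset, ((∏ j ∈ A, (1 - c j)) * ∏ j ∈ G \ A, c j) *
        listE v N (fun s => if ∀ j ∈ A, j ∉ s.map φ then 1 else 0) := by
      rw [listE_sum]
      simp only [listE_const_mul]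
    _ ≤ ∑ A ∈ G.powerset, ((∏ j ∈ A, (1 - c j)) * ∏ j ∈ G \ A, c j) *
        ∏ j ∈ A, Real.exp (-(N * labelWeight v φ j)) := by
      refine Finset.sum_le_sum fun A _ => mul_le_mul_of_nonneg_left (listE_avoid_le hv hv1 φ N A) ?_
      exact mul_nonneg (Finset.prod_nonneg fun j _ => hc1 j) (Finset.prod_nonneg fun j _ => hc0 j)
    _ = ∏ j ∈ G, ((1 - c j) * Real.exp (-(N * labelWeight v φ j)) + c j) := by
      rw [Finset.prod_add]
      refine Finset.sum_congr rfl fun A _ => ?_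
      rw [Finset.prod_mul_distrib, mul_right_comm]
    _ = _ := Finset.prod_congr rfl fun j _ => by ring

theorem div_two_le_one_sub_exp_neg {z : ℝ} (hz : 0 ≤ z) (hz1 : z ≤ 1) :
    z / 2 ≤ 1 - Real.exp (-z) := by
  have h1 : Real.exp (-z) ≤ 1 / (1 + z) := by
    rw [Real.exp_neg, ← one_div]
    exact one_div_le_one_div_of_le (by linarith) (by linarith [Real.add_one_le_exp z])
  have h2 : 1 / (1 + z) ≤ 1 - z / 2 := by
    rw [div_le_iff₀ (by linarith)]
    nlinarith
  linarith

/-- Birthday paradox: `√k / μ` samples from each of two distributions that share a mass `μ` on a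
set of at most `k` labels have one of these labels in common with probability at least `1 / 5`. -/
theorem listE_collision_ge {v w : β → ℝ} (hv : ∀ x, 0 ≤ v x) (hv1 : ∑ x, v x = 1)
    (hw : ∀ x, 0 ≤ w x) (hw1 : ∑ x, w x = 1) (φ : β → ℕ) (N : ℕ) (G : Finset ℕ) {k : ℕ}
    (hG : G.card ≤ k)
    (hN : √(k : ℝ) ≤ N * ∑ j ∈ G, min (labelWeight v φ j) (labelWeight w φ j)) (hk : 1 ≤ k) :
    1 / 5 ≤ listE v N (fun s => listE w N fun t =>
      if ∃ j ∈ G, j ∈ s.map φ ∧ j ∈ t.map φ then 1 else 0) := by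
  set z : ℕ → ℝ := fun j => N * min (labelWeight v φ j) (labelWeight w φ j) with hzdef
  set u : ℕ → ℝ := fun j => min (z j) 1 with hu
  have hz : ∀ j, 0 ≤ z j := fun j => mul_nonneg N.cast_nonneg
    (le_min (labelWeight_nonneg hv φ j) (labelWeight_nonneg hw φ j))
  have hu0 : ∀ j, 0 ≤ u j := fun j => le_min (hz j) zero_le_one
  have hb : ∀ j, ∀ y : ℝ, z j ≤ y → u j / 2 ≤ 1 - Real.exp (-y) := by
    intro j y hy
    refine (div_two_le_one_sub_exp_neg (hu0 j) (min_le_right _ _)).trans ?_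
    have : Real.exp (-y) ≤ Real.exp (-u j) :=
      Real.exp_le_exp.2 (neg_le_neg ((min_le_left _ _).trans hy))
    linarith
  -- Either one label alone is expected in each list, or no `z j` is truncated and Cauchy–Schwarz
  -- gives `∑ z j ^ 2 ≥ (∑ z j) ^ 2 / k ≥ 1`.
  have hsq : 1 ≤ ∑ j ∈ G, u j ^ 2 := by
    by_cases h : ∃ j ∈ G, 1 ≤ z j
    · obtain ⟨j, hj, hzj⟩ := h
      refine le_trans ?_ (Finset.single_le_sum (fun i _ => sq_nonneg (u i)) hj)
      simp [hu, min_eq_right hzj]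
    · push Not at h
      have hsum : √(k : ℝ) ≤ ∑ j ∈ G, u j := by
        refine hN.trans (le_of_eq ?_)
        rw [Finset.mul_sum]
        exact Finset.sum_congr rfl fun j hj => (min_eq_left (h j hj).le).symm
      have hcs := sq_sum_le_card_mul_sum_sq (s := G) (f := u)
      have h1 : (k : ℝ) ≤ (∑ j ∈ G, u j) ^ 2 := by
        calc (k : ℝ) = √(k : ℝ) ^ 2 := (Real.sq_sqrt k.cast_nonneg).symm
          _ ≤ _ := pow_le_pow_left₀ (Real.sqrt_nonneg _) hsum 2
      have hG' : (G.card : ℝ) ≤ k := Nat.cast_le.2 hG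
      have hS : 0 ≤ ∑ j ∈ G, u j ^ 2 := Finset.sum_nonneg fun j _ => sq_nonneg _
      have hk' : (1 : ℝ) ≤ k := by exact_mod_cast hk
      have := mul_le_mul_of_nonneg_right hG' hS
      by_contra! hlt
      nlinarith
  have hprod : ∏ j ∈ G, (1 - (1 - Real.exp (-(N * labelWeight v φ j))) *
      (1 - Real.exp (-(N * labelWeight w φ j)))) ≤ Real.exp (-(1 / 4)) := by
    calc _ ≤ ∏ j ∈ G, Real.exp (-(u j ^ 2 / 4)) := by
          refine Finset.prod_le_prod (fun j _ => ?_) fun j _ => ?_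
          · have h1 : Real.exp (-(N * labelWeight v φ j)) ≤ 1 := Real.exp_le_one_iff.2
              (neg_nonpos.2 (mul_nonneg N.cast_nonneg (labelWeight_nonneg hv φ j)))
            have h2 : Real.exp (-(N * labelWeight w φ j)) ≤ 1 := Real.exp_le_one_iff.2
              (neg_nonpos.2 (mul_nonneg N.cast_nonneg (labelWeight_nonneg hw φ j)))
            nlinarith [Real.exp_pos (-(N * labelWeight v φ j)),
              Real.exp_pos (-(N * labelWeight w φ j))]
          · have h1 := hb j (N * labelWeight v φ j)
              (mul_le_mul_of_nonneg_left (min_le_left _ _) N.cast_nonneg)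
            have h2 := hb j (N * labelWeight w φ j)
              (mul_le_mul_of_nonneg_left (min_le_right _ _) N.cast_nonneg)
            have h0 : 0 ≤ u j / 2 := div_nonneg (hu0 j) zero_le_two
            have h3 := mul_le_mul h1 h2 h0 (h0.trans h1)
            linarith [Real.add_one_le_exp (-(u j ^ 2 / 4))]
      _ = Real.exp (-((∑ j ∈ G, u j ^ 2) / 4)) := by
          rw [← Real.exp_sum, Finset.sum_neg_distrib, Finset.sum_div]
      _ ≤ _ := Real.exp_le_exp.2 (by linarith)
  have h45 : Real.exp (-(1 / 4)) ≤ 4 / 5 := by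
    rw [Real.exp_neg, show (4 : ℝ) / 5 = (5 / 4)⁻¹ by norm_num]
    exact inv_anti₀ (by norm_num) (by linarith [Real.add_one_le_exp (1 / 4 : ℝ)])
  have hno := (listE_no_collision_le hv hv1 hw hw1 φ N G).trans (hprod.trans h45)
  have hadd : listE v N (fun s => listE w N fun t =>
        if ∃ j ∈ G, j ∈ s.map φ ∧ j ∈ t.map φ then (1 : ℝ) else 0) +
      listE v N (fun s => listE w N fun t =>
        if ∃ j ∈ G, j ∈ s.map φ ∧ j ∈ t.map φ then 0 else 1) = 1 := by
    simp only [← listE_add]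
    refine Eq.trans ?_ (listE_const hv1 N 1)
    congr 1
    funext s
    refine Eq.trans ?_ (listE_const hw1 N 1)
    congr 1
    funext t
    split_ifs <;> norm_num
  linarith

/-- The first sample with label `j` is distributed as `w` conditioned on this label, independently
of the labels of all samples. -/
theorem listE_first (w : β → ℝ) (φ : β → ℕ) (j N : ℕ) (F : List ℕ → ℝ) (g : β → ℝ) :
    listE w N (fun l => (l.find? fun x => φ x == j).elim 0 fun x => F (l.map φ) * g x) *
        labelWeight w φ j =
      listE w N (fun l => if j ∈ l.map φ then F (l.map φ) else 0) *
        ∑ x, if φ x = j then w x * g x else 0 := by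
  induction N generalizing F with
  | zero => simp [listE]
  | succ N ih =>
    set C := listE w N fun l => F (j :: l.map φ) with hC
    set M := ∑ x, if φ x = j then w x * g x else 0 with hM
    have h1 : ∀ x, w x * listE w N (fun l =>
        ((x :: l).find? fun x => φ x == j).elim 0 fun y => F ((x :: l).map φ) * g y) *
          labelWeight w φ j =
        (if φ x = j then w x * g x else 0) * (C * labelWeight w φ j) +
        if φ x = j then 0 else w x * listE w N (fun l => if j ∈ l.map φ then
          F (φ x :: l.map φ) else 0) * M := by
      intro x
      by_cases hx : φ x = j
      · simp only [List.find?_cons, hx, beq_self_eq_true, Option.elim_some, List.map_cons, if_true,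
          add_zero]
        simp only [mul_comm (F _), listE_const_mul]
        ring
      · have hx' : (φ x == j) = false := beq_eq_false_iff_ne.2 hx
        simp only [List.find?_cons, hx', List.map_cons, if_neg hx, zero_mul, zero_add]
        rw [mul_assoc, ih fun l => F (φ x :: l), mul_assoc]
    have h2 : ∀ x, w x * listE w N (fun l =>
        if j ∈ (x :: l).map φ then F ((x :: l).map φ) else 0) * M =
        (if φ x = j then w x else 0) * (C * M) +
        if φ x = j then 0 else w x * listE w N (fun l => if j ∈ l.map φ then
          F (φ x :: l.map φ) else 0) * M := by
      intro x
      by_cases hx : φ x = j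
      · simp [hx, ← hC, mul_assoc]
      · have hx' : j ≠ φ x := fun h => hx h.symm
        simp [hx, hx']
    simp only [listE]
    rw [Finset.sum_mul, Finset.sum_congr rfl fun x _ => h1 x, Finset.sum_mul,
      Finset.sum_congr rfl fun x _ => h2 x, Finset.sum_add_distrib, Finset.sum_add_distrib,
      ← Finset.sum_mul, ← Finset.sum_mul]
    rw [labelWeight]
    ring

end Collisions

/-! ### Bad pairs in a bucket -/

section BadPairs

variable {β : Type}

/-- In the comparison of two functions with the same sum, at least `E - α p` of the excess `E` of
`P` over `R` lies on points where `P` exceeds `R` by the factor `1 + α`. -/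
theorem excess_sub_le {S : Finset β} {P R : β → ℝ} (hP : ∀ x ∈ S, 0 ≤ P x)
    (hR : ∀ x ∈ S, 0 ≤ R x) {α : ℝ} (hα : 0 ≤ α) :
    ∑ x ∈ S, max (P x - R x) 0 - α * ∑ x ∈ S, R x ≤
      ∑ x ∈ S with (1 + α) * R x ≤ P x, P x := by
  rw [Finset.mul_sum, ← Finset.sum_sub_distrib, Finset.sum_filter]
  refine Finset.sum_le_sum fun x hx => ?_
  have h1 := hP x hx
  have h2 := hR x hx
  have h3 : 0 ≤ α * R x := mul_nonneg hα h2
  split_ifs with h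
  · have : max (P x - R x) 0 ≤ P x := max_le (by linarith) h1
    linarith
  · have : max (P x - R x) 0 ≤ α * R x := max_le (by linarith) h3
    linarith

open Classical in
theorem mul_sum_le_sum_bad {S : Finset β} {P R : β → ℝ} (hP : ∀ x ∈ S, 0 ≤ P x)
    (hR : ∀ x ∈ S, 0 ≤ R x) {A B : β → Prop} {bad : β → β → Prop}
    (h : ∀ a ∈ S, ∀ b ∈ S, A a → B b → bad a b) :
    (∑ a ∈ S with A a, P a) * ∑ b ∈ S with B b, R b ≤
      ∑ a ∈ S, ∑ b ∈ S, if bad a b then P a * R b else 0 := by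
  rw [Finset.sum_mul_sum, Finset.sum_filter]
  refine Finset.sum_le_sum fun a ha => ?_
  have hnn : ∀ b ∈ S, (0 : ℝ) ≤ if bad a b then P a * R b else 0 := fun b hb => by
    split_ifs
    exacts [mul_nonneg (hP a ha) (hR b hb), le_rfl]
  split_ifs with hA
  · rw [Finset.sum_filter]
    refine Finset.sum_le_sum fun b hb => ?_
    split_ifs with h1 h2
    · exact le_rfl
    · exact absurd (h a ha b hb hA h1) h2
    · exact mul_nonneg (hP a ha) (hR b hb)
    · exact le_rfl
  · exact Finset.sum_nonneg hnn

open Classical in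
/-- If `P` and `R` have the same mass `p` and total variation distance `E`, then an independent
pair `(a, b)` from `P × R` has `R b / P b ≥ (1 + α) (R a / P a)` with probability at least
`(E / p - α) / 2`.  According to whether `R ≥ P` holds for the major part of `R`, the bad pairs
are found among those with small `R a / P a` and `R b ≥ P b`, or those with `R a < P a` and large
`R b / P b`. -/
theorem bad_pairs_of_sum_eq {S : Finset β} {P R : β → ℝ} (hP : ∀ x ∈ S, 0 ≤ P x)
    (hR : ∀ x ∈ S, 0 ≤ R x) (hsum : ∑ x ∈ S, R x = ∑ x ∈ S, P x) {α : ℝ} (hα : 0 ≤ α) :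
    (1 / 2) * (∑ x ∈ S, max (P x - R x) 0 - α * ∑ x ∈ S, P x) * ∑ x ∈ S, P x ≤
      ∑ a ∈ S, ∑ b ∈ S, if (1 + α) * P b * R a ≤ R b * P a then P a * R b else 0 := by
  set p := ∑ x ∈ S, P x with hp
  set E := ∑ x ∈ S, max (P x - R x) 0 with hE
  have hp0 : 0 ≤ p := Finset.sum_nonneg hP
  rcases le_or_gt (E - α * p) 0 with hneg | hpos
  · refine le_trans (mul_nonpos_of_nonpos_of_nonneg (by linarith) hp0) ?_
    refine Finset.sum_nonneg fun a ha => Finset.sum_nonneg fun b hb => ?_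
    split_ifs
    exacts [mul_nonneg (hP a ha) (hR b hb), le_rfl]
  rcases le_or_gt (p / 2) (∑ b ∈ S with P b ≤ R b, R b) with h1 | h1
  · have h2 := excess_sub_le hP hR hα
    rw [hsum, ← hE] at h2
    refine le_trans ?_ (mul_sum_le_sum_bad (A := fun a => (1 + α) * R a ≤ P a)
      (B := fun b => P b ≤ R b) hP hR ?_)
    · have := mul_le_mul h2 h1 (by linarith) (hpos.le.trans h2)
      linarith
    · intro a ha b hb hA hB
      have := mul_le_mul hA hB (hP b hb) (hP a ha)
      linarith
  · have h2 := excess_sub_le hR hP hα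
    have hE' : ∑ x ∈ S, max (R x - P x) 0 = E := by
      have h3 : ∑ x ∈ S, (max (P x - R x) 0 - max (R x - P x) 0) = ∑ x ∈ S, (P x - R x) := by
        refine Finset.sum_congr rfl fun x _ => ?_
        rcases le_total (P x) (R x) with h | h
        · rw [max_eq_right (by linarith), max_eq_left (by linarith)]; ring
        · rw [max_eq_left (by linarith), max_eq_right (by linarith)]; ring
      rw [Finset.sum_sub_distrib, Finset.sum_sub_distrib, hsum, sub_self] at h3
      linarith
    rw [hE', ← hp] at h2
    have h4 : p / 2 ≤ ∑ a ∈ S with R a < P a, P a := by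
      have h5 := Finset.sum_filter_add_sum_filter_not S (fun b => P b ≤ R b) R
      have h6 : ∑ a ∈ S with ¬ P a ≤ R a, R a ≤ ∑ a ∈ S with R a < P a, P a := by
        simp only [not_le]
        exact Finset.sum_le_sum fun a ha => (Finset.mem_filter.1 ha).2.le
      rw [hsum] at h5
      linarith
    refine le_trans ?_ (mul_sum_le_sum_bad (A := fun a => R a < P a)
      (B := fun b => (1 + α) * P b ≤ R b) hP hR ?_)
    · have := mul_le_mul h4 h2 hpos.le ((div_nonneg hp0 zero_le_two).trans h4)
      linarith
    · intro a ha b hb hA hB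
      exact mul_le_mul hB hA.le (hR a ha) (hR b hb)

open Classical in
theorem bad_pairs {S : Finset β} {P Q : β → ℝ} (hP : ∀ x ∈ S, 0 ≤ P x)
    (hQ : ∀ x ∈ S, 0 ≤ Q x) (hp : 0 < ∑ x ∈ S, P x) (hq : 0 < ∑ x ∈ S, Q x) {α : ℝ} (hα : 0 ≤ α) :
    (1 / 2) * (∑ x ∈ S, max (P x - (∑ x ∈ S, P x) / (∑ x ∈ S, Q x) * Q x) 0 - α * ∑ x ∈ S, P x) *
        ∑ x ∈ S, Q x ≤
      ∑ a ∈ S, ∑ b ∈ S, if (1 + α) * P b * Q a ≤ Q b * P a then P a * Q b else 0 := by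
  set p := ∑ x ∈ S, P x with hpdef
  set q := ∑ x ∈ S, Q x with hqdef
  have hr : 0 < p / q := div_pos hp hq
  have h := bad_pairs_of_sum_eq (R := fun x => p / q * Q x) hP
    (fun x hx => mul_nonneg hr.le (hQ x hx))
    (by rw [← Finset.mul_sum, ← hqdef, div_mul_cancel₀ _ hq.ne']) hα
  have h1 : ∑ a ∈ S, ∑ b ∈ S, (if (1 + α) * P b * (p / q * Q a) ≤ p / q * Q b * P a then
      P a * (p / q * Q b) else 0) =
      p / q * ∑ a ∈ S, ∑ b ∈ S, if (1 + α) * P b * Q a ≤ Q b * P a then P a * Q b else 0 := by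
    simp only [Finset.mul_sum]
    refine Finset.sum_congr rfl fun a _ => Finset.sum_congr rfl fun b _ => ?_
    have h2 : (1 + α) * P b * (p / q * Q a) ≤ p / q * Q b * P a ↔
        (1 + α) * P b * Q a ≤ Q b * P a := by
      rw [show (1 + α) * P b * (p / q * Q a) = p / q * ((1 + α) * P b * Q a) by ring,
        mul_assoc (p / q) (Q b) (P a), mul_le_mul_iff_right₀ hr]
    simp only [h2]
    split_ifs <;> ring
  rw [h1, ← hpdef] at h
  refine le_of_mul_le_mul_left (le_trans (le_of_eq ?_) h) hr
  field_simp

end BadPairs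

/-! ### The mass of the buckets with many bad pairs -/

section FarBuckets

variable {β : Type} [Fintype β]

/-- The mass of the bucket `j` times the total variation distance of the conditional
distributions in it.  If the bucket has `Q`-mass zero, the division by zero makes this the whole
`P`-mass of the bucket. -/
noncomputable def bucketExcess (P Q : β → ℝ) (φ : β → ℕ) (j : ℕ) : ℝ :=
  ∑ x with φ x = j, max (P x - labelWeight P φ j / labelWeight Q φ j * Q x) 0

theorem labelWeight_eq_sum_filter (P : β → ℝ) (φ : β → ℕ) (j : ℕ) :
    labelWeight P φ j = ∑ x with φ x = j, P x := by
  rw [Finset.sum_filter, labelWeight]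

theorem bucketExcess_le {P Q : β → ℝ} (hP : ∀ x, 0 ≤ P x) (hQ : ∀ x, 0 ≤ Q x) (φ : β → ℕ)
    (j : ℕ) : bucketExcess P Q φ j ≤ labelWeight P φ j := by
  rw [labelWeight_eq_sum_filter]
  refine Finset.sum_le_sum fun x _ => max_le ?_ (hP x)
  have := mul_nonneg (div_nonneg (labelWeight_nonneg hP φ j) (labelWeight_nonneg hQ φ j)) (hQ x)
  linarith

theorem sum_max_sub_le {P Q : β → ℝ} (hP : ∀ x, 0 ≤ P x) (hQ : ∀ x, 0 ≤ Q x) (φ : β → ℕ)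
    (j : ℕ) : ∑ x with φ x = j, max (P x - Q x) 0 ≤
      bucketExcess P Q φ j + max (labelWeight P φ j - labelWeight Q φ j) 0 := by
  set p := labelWeight P φ j with hp
  set q := labelWeight Q φ j with hq
  have hp0 : 0 ≤ p := labelWeight_nonneg hP φ j
  have hq0 : 0 ≤ q := labelWeight_nonneg hQ φ j
  have h1 : ∑ x with φ x = j, max (P x - Q x) 0 ≤
      ∑ x with φ x = j, (max (P x - p / q * Q x) 0 + max (p / q - 1) 0 * Q x) := by
    refine Finset.sum_le_sum fun x _ => max_le ?_ ?_
    · have h2 := le_max_left (P x - p / q * Q x) 0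
      have h3 := mul_le_mul_of_nonneg_right (le_max_left (p / q - 1) 0) (hQ x)
      linarith
    · exact add_nonneg (le_max_right _ _) (mul_nonneg (le_max_right _ _) (hQ x))
  refine h1.trans ?_
  rw [Finset.sum_add_distrib, ← Finset.mul_sum, ← labelWeight_eq_sum_filter Q, ← hq]
  refine add_le_add le_rfl ?_
  rcases hq0.eq_or_lt with h0 | h0
  · rw [← h0, mul_zero]
    exact le_max_right _ _
  · rw [max_mul_of_nonneg _ _ hq0, zero_mul, sub_mul, div_mul_cancel₀ _ h0.ne', one_mul]

/-- The buckets `j ≥ 1` in which the conditional distributions are at total variation distance at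
least `ε`. -/
noncomputable def farBuckets (P Q : β → ℝ) (φ : β → ℕ) (k : ℕ) (ε : ℝ) : Finset ℕ :=
  open Classical in (Finset.Icc 1 k).filter fun j =>
    0 < labelWeight P φ j ∧ 0 < labelWeight Q φ j ∧ ε * labelWeight P φ j ≤ bucketExcess P Q φ j

theorem half_sum_abs_eq_sum_max {ι : Type} (s : Finset ι) (u v : ι → ℝ)
    (h : ∑ i ∈ s, u i = ∑ i ∈ s, v i) :
    (1 / 2) * ∑ i ∈ s, |u i - v i| = ∑ i ∈ s, max (u i - v i) 0 := by
  have h1 : ∑ i ∈ s, |u i - v i| = ∑ i ∈ s, (2 * max (u i - v i) 0 - (u i - v i)) := by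
    refine Finset.sum_congr rfl fun i _ => ?_
    rcases le_total (u i) (v i) with hi | hi
    · rw [max_eq_right (by linarith), abs_of_nonpos (by linarith)]; ring
    · rw [max_eq_left (by linarith), abs_of_nonneg (by linarith)]; ring
  rw [h1, Finset.sum_sub_distrib, ← Finset.mul_sum, Finset.sum_sub_distrib, h]
  ring

/-- Two distributions at total variation distance more than `η`, whose bucket distributions are at
distance `d`, share a large mass on the far buckets. -/
theorem le_sum_min_farBuckets {P Q : β → ℝ} (hP : ∀ x, 0 ≤ P x) (hP1 : ∑ x, P x = 1)
    (hQ : ∀ x, 0 ≤ Q x) (hQ1 : ∑ x, Q x = 1) {φ : β → ℕ} {k : ℕ} (hφ : ∀ x, φ x ≤ k)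
    {η d ε : ℝ} (h0 : labelWeight P φ 0 ≤ η / 100) (hε : 0 ≤ ε)
    (hη : η ≤ (1 / 2) * ∑ x, |P x - Q x|)
    (hd : (1 / 2) * ∑ i ∈ Finset.range (k + 1), |labelWeight P φ i - labelWeight Q φ i| = d) :
    0.99 * η - 2 * d - ε ≤
      ∑ j ∈ farBuckets P Q φ k ε, min (labelWeight P φ j) (labelWeight Q φ j) := by
  classical
  have hsP := sum_range_labelWeight hP1 hφ
  have hsQ := sum_range_labelWeight hQ1 hφ
  rw [half_sum_abs_eq_sum_max _ _ _ (hsP.trans hsQ.symm)] at hd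
  rw [half_sum_abs_eq_sum_max _ _ _ (hP1.trans hQ1.symm)] at hη
  have hfib : ∑ x, max (P x - Q x) 0 =
      ∑ j ∈ Finset.range (k + 1), ∑ x with φ x = j, max (P x - Q x) 0 :=
    (Finset.sum_fiberwise_of_maps_to
      (fun x _ => Finset.mem_range.2 (Nat.lt_succ_of_le (hφ x))) _).symm
  have h1 : η - d ≤ ∑ j ∈ Finset.range (k + 1), bucketExcess P Q φ j := by
    have := Finset.sum_le_sum fun j (_ : j ∈ Finset.range (k + 1)) => sum_max_sub_le hP hQ φ j
    rw [← hfib, Finset.sum_add_distrib, hd] at this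
    linarith
  have hsplit : ∀ f : ℕ → ℝ, ∑ j ∈ Finset.range (k + 1), f j = f 0 + ∑ j ∈ Finset.Icc 1 k, f j := by
    intro f
    rw [Finset.range_eq_Ico, Finset.sum_eq_sum_Ico_succ_bot (Nat.succ_pos k)]
    rfl
  rw [hsplit] at h1 hd hsP
  have h2 : ∑ j ∈ Finset.Icc 1 k, bucketExcess P Q φ j ≤
      ∑ j ∈ Finset.Icc 1 k, (ε * labelWeight P φ j +
        (if 0 < labelWeight P φ j ∧ 0 < labelWeight Q φ j ∧
            ε * labelWeight P φ j ≤ bucketExcess P Q φ j then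
          min (labelWeight P φ j) (labelWeight Q φ j) else 0) +
        max (labelWeight P φ j - labelWeight Q φ j) 0) := by
    refine Finset.sum_le_sum fun j _ => ?_
    have hp0 := labelWeight_nonneg hP φ j
    have hq0 := labelWeight_nonneg hQ φ j
    have hE := bucketExcess_le hP hQ φ j
    have hmul := mul_nonneg hε hp0
    have hmax1 := le_max_left (labelWeight P φ j - labelWeight Q φ j) 0
    have hmax2 := le_max_right (labelWeight P φ j - labelWeight Q φ j) 0
    split_ifs with h
    · have : labelWeight P φ j ≤ min (labelWeight P φ j) (labelWeight Q φ j) +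
          max (labelWeight P φ j - labelWeight Q φ j) 0 := by
        rcases le_total (labelWeight P φ j) (labelWeight Q φ j) with h' | h'
        · rw [min_eq_left h']; linarith
        · rw [min_eq_right h']; linarith
      linarith
    · rcases hp0.eq_or_lt with hp | hp
      · linarith
      rcases hq0.eq_or_lt with hq | hq
      · linarith
      have : bucketExcess P Q φ j < ε * labelWeight P φ j := by
        by_contra! hlt
        exact h ⟨hp, hq, hlt⟩
      linarith
  rw [Finset.sum_add_distrib, Finset.sum_add_distrib, ← Finset.mul_sum, ← Finset.sum_filter] at h2
  have hp0 := labelWeight_nonneg hP φ 0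
  have hE0 := bucketExcess_le hP hQ φ 0
  have hmax := le_max_right (labelWeight P φ 0 - labelWeight Q φ 0) 0
  have h3 : ε * ∑ j ∈ Finset.Icc 1 k, labelWeight P φ j ≤ ε * 1 :=
    mul_le_mul_of_nonneg_left (by linarith) hε
  rw [farBuckets]
  linarith

end FarBuckets

/-! ### The test of a pair -/

section PairTest

variable {n : ℕ}

/-- The indicator of acceptance. -/
def accVal : Verdict → ℝ
  | Verdict.accept => 1
  | Verdict.reject => 0

/-- The indicator of rejection. -/
def rejVal : Verdict → ℝ
  | Verdict.accept => 0
  | Verdict.reject => 1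

theorem accVal_nonneg (v : Verdict) : 0 ≤ accVal v := by cases v <;> simp [accVal]

theorem accVal_le_one (v : Verdict) : accVal v ≤ 1 := by cases v <;> simp [accVal]

theorem ev_accVal_add_rejVal (P Q : PMF (Cube n)) (A : OracleProg n Verdict) :
    ev P Q A accVal + ev P Q A rejVal = ev P Q A fun _ => 1 := by
  rw [← ev_add]
  congr 1
  funext v
  cases v <;> simp [accVal, rejVal]

theorem ev_allAccept_accVal {β : Type} (P Q : PMF (Cube n)) (test : β → OracleProg n Verdict)
    (l : List β) :
    ev P Q (allAccept test l) accVal = (l.map fun b => ev P Q (test b) accVal).prod := by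
  induction l with
  | nil => rfl
  | cons b l ih =>
    rw [allAccept, ev_bind, List.map_cons, List.prod_cons, ← ih, ← ev_mul_const]
    congr 1
    funext v
    cases v
    · simp [accVal]
    · simp [accVal, ev_pure]

theorem ev_allAccept_one {β : Type} (P Q : PMF (Cube n)) {test : β → OracleProg n Verdict}
    {l : List β} (h : ∀ b ∈ l, ev P Q (test b) (fun _ => 1) = 1) :
    ev P Q (allAccept test l) (fun _ => 1) = 1 := by
  induction l with
  | nil => rfl
  | cons b l ih =>
    rw [allAccept, ev_bind]
    refine Eq.trans ?_ (h b List.mem_cons_self)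
    congr 1
    funext v
    cases v
    · exact ih fun c hc => h c (List.mem_cons_of_mem _ hc)
    · rfl

theorem ev_bias_self (P Q : PMF (Cube n)) (p : Cube n) (r : ℕ) (g : ℝ → ℝ) :
    ev P Q (bias p p r) g = g (1 / 2) := by
  rw [bias, dif_pos rfl]
  rfl

theorem ev_bias {p q : Cube n} (h : p ≠ q) (P Q : PMF (Cube n)) (r : ℕ) (g : ℝ → ℝ) :
    ev P Q (bias p q r) g = listE (condWeight Q p q) r fun l => g ((l.count p : ℝ) / r) := by
  rw [bias, dif_neg h, ev_bind, ev_repeatN (w := condWeight Q p q) (φ := id) fun g => rfl]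
  simp only [List.map_id]
  rfl

theorem ev_pairTest_one {P Q : PMF (Cube n)} {q : Cube n × ℝ} (hq : 0 < wt Q q.1)
    (p : Cube n × ℝ) (ε α δ : ℝ) (m t : ℕ) :
    ev P Q (pairTest ε α δ m t p q) (fun _ => 1) = 1 := by
  unfold pairTest
  simp only [ev_bind, ev_pure]
  by_cases h : p.1 = q.1
  · rw [h, ev_bias_self]
  · rw [ev_bias h, listE_const (sum_condWeight h hq)]

theorem sum_map_ite_eq_count {γ : Type} [DecidableEq γ] (l : List γ) (p : γ) :
    (l.map fun x => if x = p then (1 : ℝ) else 0).sum = l.count p := by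
  induction l with
  | nil => simp
  | cons x l ih =>
    rw [List.map_cons, List.sum_cons, ih, List.count_cons]
    by_cases h : x = p <;> simp [h, add_comm]

theorem sum_condWeight_mul_ite (Q : PMF (Cube n)) (p q : Cube n) :
    ∑ x, condWeight Q p q x * (if x = p then (1 : ℝ) else 0) = wt Q p / (wt Q p + wt Q q) := by
  simp [condWeight, wt]

theorem exp_neg_two_mul_le {r M d : ℝ} (hM : 0 < M) (hd : 0 < d)
    (hr : 2 * Real.log M / d ^ 2 ≤ r) : Real.exp (-(2 * r * (d / 2) ^ 2)) ≤ M⁻¹ := by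
  rw [← Real.exp_log (inv_pos.2 hM), Real.log_inv, Real.exp_le_exp]
  rw [div_le_iff₀ (by positivity)] at hr
  linarith

theorem threshold_lt {a b x α : ℝ} (ha : 0 < a) (hb : 0 < b) (hx : 0 ≤ x) (hxα : x < α) :
    a / (a + b * (1 + α)) < a / (a + b * (1 + x)) := by
  apply div_lt_div_of_pos_left ha
  · positivity
  · gcongr

theorem ite_mem_Icc {p : Prop} [Decidable p] : (if p then (1 : ℝ) else 0) ∈ Set.Icc (0 : ℝ) 1 := by
  split_ifs <;> simp

/-- A pair whose `Q`-odds of `p` against `q` are at least `1 / (1 + 2 ε / (1 - ε))` times the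
`P`-odds is accepted, except with probability `δ / (4 m t)`. -/
theorem pairTest_accepts {P Q : PMF (Cube n)} {p q : Cube n} {ε α δ : ℝ} {m t : ℕ}
    (hx : 0 ≤ 2 * ε / (1 - ε)) (hxα : 2 * ε / (1 - ε) < α) (hm : 1 ≤ m) (ht : 1 ≤ t)
    (hδ : 0 < δ) (hδ1 : δ ≤ 1) (hp : 0 < wt P p) (hq : 0 < wt P q) (hQq : 0 < wt Q q)
    (hgood : wt Q q * wt P p ≤ (1 + 2 * ε / (1 - ε)) * wt P q * wt Q p) :
    1 - δ / (4 * m * t) ≤ ev P Q (pairTest ε α δ m t (p, wt P p) (q, wt P q)) accVal := by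
  unfold pairTest
  simp only [ev_bind, ev_pure]
  set h := wt P p / (wt P p + wt P q * (1 + 2 * ε / (1 - ε))) with hh
  set l := wt P p / (wt P p + wt P q * (1 + α)) with hl
  have hlh : l < h := threshold_lt hp hq hx hxα
  set r := ⌈2 * Real.log (4 * m * t / δ) / (h - l) ^ 2⌉₊ with hr
  have hm' : (1 : ℝ) ≤ m := by exact_mod_cast hm
  have ht' : (1 : ℝ) ≤ t := by exact_mod_cast ht
  have hmt : (1 : ℝ) ≤ m * t := one_le_mul_of_one_le_of_one_le hm' ht'
  have hM : 1 < 4 * m * t / δ := by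
    rw [lt_div_iff₀ hδ]
    linarith
  have hrle := Nat.le_ceil (2 * Real.log (4 * m * t / δ) / (h - l) ^ 2)
  rw [← hr] at hrle
  have hrpos : (0 : ℝ) < r :=
    lt_of_lt_of_le (div_pos (mul_pos two_pos (Real.log_pos hM)) (by
      have := sub_pos.2 hlh
      positivity)) hrle
  by_cases hpq : p = q
  · subst hpq
    have h2 : h ≤ 1 / 2 := by
      rw [hh, div_le_div_iff₀ (by positivity) two_pos]
      nlinarith
    rw [ev_bias_self, if_neg (by linarith)]
    have : 0 ≤ δ / (4 * m * t) := by positivity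
    simp only [accVal]
    linarith
  · rw [ev_bias hpq]
    have htail := hoeffding_lower (w := condWeight Q p q) (condWeight_nonneg Q p q)
      (sum_condWeight hpq hQq) (f := fun x => if x = p then (1 : ℝ) else 0)
      (fun x => ite_mem_Icc) r (s := (h - l) / 2) (by linarith)
    rw [sum_condWeight_mul_ite] at htail
    have htail' := htail.trans (exp_neg_two_mul_le (one_pos.trans hM) (sub_pos.2 hlh) hrle)
    rw [inv_div] at htail'
    have hc : h ≤ wt Q p / (wt Q p + wt Q q) := by
      have := wt_nonneg Q p
      rw [hh, div_le_div_iff₀ (by positivity) (by positivity)]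
      linarith
    have hsplit : 1 - listE (condWeight Q p q) r (fun l' =>
        if (l'.map fun x => if x = p then (1 : ℝ) else 0).sum ≤
          r * (wt Q p / (wt Q p + wt Q q) - (h - l) / 2) then 1 else 0) ≤
        listE (condWeight Q p q) r (fun l' => accVal
          (if (l'.count p : ℝ) / r ≤ (h + l) / 2 then Verdict.reject else Verdict.accept)) := by
      rw [sub_le_iff_le_add, ← listE_add]
      refine (listE_const (sum_condWeight hpq hQq) r (1 : ℝ)).symm.le.trans
        (listE_mono (condWeight_nonneg Q p q) fun l' _ _ => ?_)
      rw [sum_map_ite_eq_count]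
      by_cases hcnt : (l'.count p : ℝ) / r ≤ (h + l) / 2
      · rw [if_pos hcnt, if_pos]
        · simp [accVal]
        · rw [div_le_iff₀ hrpos] at hcnt
          refine hcnt.trans ?_
          rw [mul_comm]
          exact mul_le_mul_of_nonneg_left (by linarith) hrpos.le
      · rw [if_neg hcnt]
        have : (0 : ℝ) ≤ if (l'.count p : ℝ) ≤
          r * (wt Q p / (wt Q p + wt Q q) - (h - l) / 2) then 1 else 0 := ite_mem_Icc.1
        simp only [accVal]
        linarith
    linarith

/-- A pair whose `Q`-odds of `p` against `q` are at most `1 / (1 + α)` times the `P`-odds is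
rejected, except with probability `δ / (4 m t)`. -/
theorem pairTest_rejects {P Q : PMF (Cube n)} {p q : Cube n} {ε α δ : ℝ} {m t : ℕ}
    (hx : 0 ≤ 2 * ε / (1 - ε)) (hxα : 2 * ε / (1 - ε) < α) (hm : 1 ≤ m) (ht : 1 ≤ t)
    (hδ : 0 < δ) (hδ1 : δ ≤ 1) (hp : 0 < wt P p) (hq : 0 < wt P q) (hQq : 0 < wt Q q)
    (hbad : (1 + α) * wt P q * wt Q p ≤ wt Q q * wt P p) :
    ev P Q (pairTest ε α δ m t (p, wt P p) (q, wt P q)) accVal ≤ δ / (4 * m * t) := by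
  unfold pairTest
  simp only [ev_bind, ev_pure]
  set h := wt P p / (wt P p + wt P q * (1 + 2 * ε / (1 - ε))) with hh
  set l := wt P p / (wt P p + wt P q * (1 + α)) with hl
  have hlh : l < h := threshold_lt hp hq hx hxα
  set r := ⌈2 * Real.log (4 * m * t / δ) / (h - l) ^ 2⌉₊ with hr
  have hm' : (1 : ℝ) ≤ m := by exact_mod_cast hm
  have ht' : (1 : ℝ) ≤ t := by exact_mod_cast ht
  have hmt : (1 : ℝ) ≤ m * t := one_le_mul_of_one_le_of_one_le hm' ht'
  have hM : 1 < 4 * m * t / δ := by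
    rw [lt_div_iff₀ hδ]
    linarith
  have hrle := Nat.le_ceil (2 * Real.log (4 * m * t / δ) / (h - l) ^ 2)
  rw [← hr] at hrle
  have hrpos : (0 : ℝ) < r :=
    lt_of_lt_of_le (div_pos (mul_pos two_pos (Real.log_pos hM)) (by
      have := sub_pos.2 hlh
      positivity)) hrle
  have hα : 0 < α := hx.trans_lt hxα
  have hpq : p ≠ q := by
    rintro rfl
    have := mul_pos (mul_pos hα hp) hQq
    linarith
  rw [ev_bias hpq]
  have htail := hoeffding_upper (w := condWeight Q p q) (condWeight_nonneg Q p q)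
    (sum_condWeight hpq hQq) (f := fun x => if x = p then (1 : ℝ) else 0)
    (fun x => ite_mem_Icc) r (s := (h - l) / 2) (by linarith)
  rw [sum_condWeight_mul_ite] at htail
  have htail' := htail.trans (exp_neg_two_mul_le (one_pos.trans hM) (sub_pos.2 hlh) hrle)
  rw [inv_div] at htail'
  have hc : wt Q p / (wt Q p + wt Q q) ≤ l := by
    have := wt_nonneg Q p
    rw [hl, div_le_div_iff₀ (by positivity) (by positivity)]
    linarith
  refine le_trans (listE_mono (condWeight_nonneg Q p q) fun l' _ _ => ?_) htail'
  rw [sum_map_ite_eq_count]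
  by_cases hcnt : (l'.count p : ℝ) / r ≤ (h + l) / 2
  · rw [if_pos hcnt]
    exact ite_mem_Icc.1
  · rw [if_neg hcnt, if_pos]
    · simp [accVal]
    · rw [not_le, lt_div_iff₀ hrpos] at hcnt
      refine le_trans ?_ hcnt.le
      rw [mul_comm ((h + l) / 2)]
      exact mul_le_mul_of_nonneg_left (by linarith) hrpos.le

end PairTest

/-! ### One round of InsideBucket -/

section Round

variable {n : ℕ}

/-- The first member of a list that lies in the bucket `j` of `P`. -/
noncomputable def firstIn (k : ℕ) (P : PMF (Cube n)) (j : ℕ) (l : List (Cube n)) :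
    Option (Cube n) :=
  l.find? fun x => label k P x == j

theorem firstIn_eq_some {k : ℕ} {P : PMF (Cube n)} {j : ℕ} {l : List (Cube n)} {x : Cube n}
    (h : firstIn k P j l = some x) : x ∈ l ∧ label k P x = j :=
  ⟨List.mem_of_find?_eq_some h, by simpa using List.find?_some h⟩

theorem exists_firstIn {k : ℕ} {P : PMF (Cube n)} {j : ℕ} {l : List (Cube n)}
    (h : j ∈ l.map (label k P)) : ∃ x, firstIn k P j l = some x := by
  obtain ⟨x, hx, rfl⟩ := List.mem_map.1 h
  exact Option.isSome_iff_exists.1 (List.find?_isSome.2 ⟨x, hx, by simp⟩)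

/-- The probability that the test for a bucket accepts, where `o` and `o'` are the first samples
of `P` and of `Q` in the bucket, if there are any. -/
noncomputable def pairAcc (P Q : PMF (Cube n)) (ε α δ : ℝ) (m t : ℕ) :
    Option (Cube n) → Option (Cube n) → ℝ
  | some p, some q => ev P Q (pairTest ε α δ m t (p, wt P p) (q, wt P q)) accVal
  | _, _ => 1

theorem find?_map_wt (k : ℕ) (P : PMF (Cube n)) (j : ℕ) (l : List (Cube n)) :
    (l.map fun x => (x, wt P x)).find? (fun x => bucketIndex k x.2 == j) =
      (firstIn k P j l).map fun x => (x, wt P x) := by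
  rw [List.find?_map]
  rfl

theorem prod_range'_eq_prod_Icc (k : ℕ) (f : ℕ → ℝ) :
    ((List.range' 1 k).map f).prod = ∏ j ∈ Finset.Icc 1 k, f j := rfl

theorem ev_insideRound_accVal (P Q : PMF (Cube n)) (k : ℕ) (ε α δ : ℝ) (m t : ℕ) :
    ev P Q (insideRound n k ε α δ m t) accVal =
      listE (wt P) m fun s => listE (wt Q) m fun u => ∏ j ∈ Finset.Icc 1 k,
        pairAcc P Q ε α δ m t (firstIn k P j s) (firstIn k P j u) := by
  unfold insideRound
  rw [ev_bind, ev_repeatN (ev_drawP P Q)]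
  congr 1
  funext s
  rw [ev_bind, ev_repeatN (ev_drawQ P Q)]
  congr 1
  funext u
  rw [ev_allAccept_accVal, prod_range'_eq_prod_Icc]
  refine Finset.prod_congr rfl fun j _ => ?_
  rw [find?_map_wt, find?_map_wt]
  cases firstIn k P j s <;> cases firstIn k P j u <;> rfl

theorem ev_insideRound_one (P Q : PMF (Cube n)) (k : ℕ) (ε α δ : ℝ) (m t : ℕ) :
    ev P Q (insideRound n k ε α δ m t) (fun _ => 1) = 1 := by
  unfold insideRound
  rw [ev_bind, ev_repeatN (ev_drawP P Q)]
  refine Eq.trans ?_ (listE_const (sum_wt P) m 1)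
  congr 1
  funext s
  rw [ev_bind, ev_repeatN (ev_drawQ P Q)]
  refine Eq.trans ?_ (listE_const (sum_wt Q) m 1)
  refine listE_congr (wt_nonneg Q) fun u _ hu => ev_allAccept_one P Q fun j _ => ?_
  rw [find?_map_wt, find?_map_wt]
  cases hs : firstIn k P j s with
  | none => rfl
  | some p =>
    cases hq : firstIn k P j u with
    | none => rfl
    | some q => exact ev_pairTest_one (q := (q, wt P q)) (hu q (firstIn_eq_some hq).1) _ _ _ _ _ _

theorem pairAcc_nonneg (P Q : PMF (Cube n)) (ε α δ : ℝ) (m t : ℕ) (o o' : Option (Cube n)) :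
    0 ≤ pairAcc P Q ε α δ m t o o' := by
  cases o <;> cases o' <;> first | exact zero_le_one | exact ev_nonneg P Q _ accVal_nonneg

theorem pairAcc_le_one {P Q : PMF (Cube n)} {ε α δ : ℝ} {m t : ℕ} {o o' : Option (Cube n)}
    (h : ∀ q, o' = some q → 0 < wt Q q) : pairAcc P Q ε α δ m t o o' ≤ 1 := by
  rcases o with _ | p
  · exact le_rfl
  rcases o' with _ | q
  · exact le_rfl
  exact (ev_mono P Q _ accVal_le_one).trans_eq
    (ev_pairTest_one (q := (q, wt P q)) (h q rfl) _ _ _ _ _ _)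

theorem one_sub_sum_le_prod {ι : Type} (s : Finset ι) {f d : ι → ℝ} (hd : ∀ i ∈ s, 0 ≤ d i)
    (hf0 : ∀ i ∈ s, 0 ≤ f i) (hf1 : ∀ i ∈ s, f i ≤ 1) (hfd : ∀ i ∈ s, 1 - d i ≤ f i) :
    1 - ∑ i ∈ s, d i ≤ ∏ i ∈ s, f i := by
  classical
  induction s using Finset.induction_on with
  | empty => simp
  | insert a s ha ih =>
    simp only [Finset.mem_insert, forall_eq_or_imp] at hd hf0 hf1 hfd
    rw [Finset.sum_insert ha, Finset.prod_insert ha]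
    have h1 := ih hd.2 hf0.2 hf1.2 hfd.2
    have h2 : ∏ i ∈ s, f i ≤ 1 := Finset.prod_le_one hf0.2 hf1.2
    have h3 : 0 ≤ ∏ i ∈ s, f i := Finset.prod_nonneg hf0.2
    nlinarith [hd.1, hf0.1, hf1.1, hfd.1]

/-- At most `m` buckets are hit by `m` samples. -/
theorem sum_Icc_ite_mem_le (k : ℕ) (l : List ℕ) (e : ℕ) :
    ∑ j ∈ Finset.Icc 1 k, (if j ∈ l then e else 0) ≤ l.length * e := by
  rw [← Finset.sum_filter, Finset.sum_const, smul_eq_mul]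
  refine Nat.mul_le_mul_right e ((Finset.card_le_card fun j hj => ?_).trans l.toFinset_card_le)
  exact List.mem_toFinset.2 (Finset.mem_filter.1 hj).2

/-- A round accepts with probability at least `1 - δ / (4 t)` if `P` and `Q` are close. -/
theorem insideRound_accepts {P Q : PMF (Cube n)} {k : ℕ} {ε α δ : ℝ} {m t : ℕ}
    (hε : 0 ≤ ε) (hε1 : ε < 1) (hxα : 2 * ε / (1 - ε) < α) (hm : 1 ≤ m) (ht : 1 ≤ t)
    (hδ : 0 < δ) (hδ1 : δ ≤ 1) (hlow : ∀ x, (1 - ε) * wt P x ≤ wt Q x)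
    (hup : ∀ x, wt Q x ≤ (1 + ε) * wt P x) :
    1 - δ / (4 * t) ≤ ev P Q (insideRound n k ε α δ m t) accVal := by
  have hε' : 0 < 1 - ε := by linarith
  have hx : 0 ≤ 2 * ε / (1 - ε) := by positivity
  have hx1 : 1 + 2 * ε / (1 - ε) = (1 + ε) / (1 - ε) := by field_simp; ring
  have hm' : (0 : ℝ) < m := by exact_mod_cast hm
  have ht' : (0 : ℝ) < t := by exact_mod_cast ht
  set e := δ / (4 * m * t) with he
  have he0 : 0 ≤ e := by positivity
  rw [ev_insideRound_accVal]
  have hme : (m : ℝ) * e = δ / (4 * t) := by rw [he]; field_simp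
  refine (listE_const (sum_wt P) m _).symm.le.trans (listE_mono (wt_nonneg P) fun s hs _ => ?_)
  refine (listE_const (sum_wt Q) m _).symm.le.trans (listE_mono (wt_nonneg Q) fun u _ hu => ?_)
  have hQ : ∀ j q, firstIn k P j u = some q → 0 < wt Q q := fun j q h =>
    hu q (firstIn_eq_some h).1
  refine le_trans ?_ (one_sub_sum_le_prod (Finset.Icc 1 k)
    (d := fun j => if j ∈ s.map (label k P) then e else 0)
    (fun j _ => by split_ifs <;> simp [he0]) (fun j _ => pairAcc_nonneg ..)
    (fun j _ => pairAcc_le_one (hQ j)) fun j hj => ?_)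
  · have h1 := sum_Icc_ite_mem_le k (s.map (label k P)) 1
    rw [List.length_map, hs, mul_one] at h1
    have h2 : ∑ j ∈ Finset.Icc 1 k, (if j ∈ s.map (label k P) then e else 0) =
        ((∑ j ∈ Finset.Icc 1 k, if j ∈ s.map (label k P) then 1 else 0 : ℕ) : ℝ) * e := by
      rw [Nat.cast_sum, Finset.sum_mul]
      refine Finset.sum_congr rfl fun j _ => ?_
      split_ifs <;> simp
    have h3 : ((∑ j ∈ Finset.Icc 1 k, if j ∈ s.map (label k P) then 1 else 0 : ℕ) : ℝ) ≤ m := by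
      exact_mod_cast h1
    have := mul_le_mul_of_nonneg_right h3 he0
    linarith
  · have hj1 : 1 ≤ j := (Finset.mem_Icc.1 hj).1
    have hge1 : (1 : ℝ) - (if j ∈ s.map (label k P) then e else 0) ≤ 1 := by
      split_ifs <;> linarith
    rcases hp : firstIn k P j s with _ | p
    · exact hge1
    rcases hq : firstIn k P j u with _ | q
    · exact hge1
    have hp' := firstIn_eq_some hp
    have hq' := firstIn_eq_some hq
    have hPp : 0 < wt P p := pos_of_bucketIndex hp'.2 hj1
    have hPq : 0 < wt P q := pos_of_bucketIndex hq'.2 hj1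
    rw [if_pos (List.mem_map.2 ⟨p, hp'.1, hp'.2⟩)]
    refine pairTest_accepts hx hxα hm ht hδ hδ1 hPp hPq (hQ j q hq) ?_
    rw [hx1, div_mul_eq_mul_div, div_mul_eq_mul_div, le_div_iff₀ hε']
    have h1 := mul_le_mul (hup q) (hlow p) (mul_nonneg hε'.le hPp.le)
      (mul_nonneg (by linarith) hPq.le)
    linarith

/-- A pair with larger `Q / P`-ratio at `q` than at `p`, by the factor `1 + α` at least. -/
def BadPair (P Q : PMF (Cube n)) (α : ℝ) (p q : Cube n) : Prop :=
  (1 + α) * wt P q * wt Q p ≤ wt Q q * wt P p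

open Classical in
/-- A label in `G` that occurs in both lists, if there is one. -/
noncomputable def commonLabel (G : Finset ℕ) (σ τ : List ℕ) : Option ℕ :=
  if h : ∃ j ∈ G, j ∈ σ ∧ j ∈ τ then some h.choose else none

theorem mem_of_commonLabel {G : Finset ℕ} {σ τ : List ℕ} {j : ℕ} (h : commonLabel G σ τ = some j) :
    j ∈ G ∧ j ∈ σ ∧ j ∈ τ := by
  unfold commonLabel at h
  split_ifs at h with h'
  rw [← Option.some.inj h]
  exact h'.choose_spec

theorem sum_ite_commonLabel (G : Finset ℕ) (σ τ : List ℕ) :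
    ∑ j ∈ G, (if commonLabel G σ τ = some j then (1 : ℝ) else 0) =
      if ∃ j ∈ G, j ∈ σ ∧ j ∈ τ then 1 else 0 := by
  by_cases h : ∃ j ∈ G, j ∈ σ ∧ j ∈ τ
  · obtain ⟨i, hi⟩ : ∃ i, commonLabel G σ τ = some i := ⟨_, dif_pos h⟩
    rw [if_pos h, Finset.sum_eq_single i]
    · rw [if_pos hi]
    · intro j _ hj
      rw [if_neg]
      rw [hi]
      exact fun h => hj (Option.some.inj h).symm
    · exact fun hn => absurd (mem_of_commonLabel hi).1 hn
  · have hi : commonLabel G σ τ = none := dif_neg h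
    simp [h, hi]

open Classical in
/-- Given that the common label is `j`, the first samples with this label are an independent pair
from the conditional distributions of `P` and `Q`. -/
theorem listE_bad_first (P Q : PMF (Cube n)) (k : ℕ) (α : ℝ) (G : Finset ℕ) (j N : ℕ) :
    listE (wt P) N (fun s => listE (wt Q) N fun u => (firstIn k P j s).elim 0 fun p =>
        (firstIn k P j u).elim 0 fun q =>
          (if commonLabel G (s.map (label k P)) (u.map (label k P)) = some j then (1 : ℝ) else 0) *
            if BadPair P Q α p q then 1 else 0) *
        (labelWeight (wt P) (label k P) j * labelWeight (wt Q) (label k P) j) =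
      listE (wt P) N (fun s => listE (wt Q) N fun u =>
          if commonLabel G (s.map (label k P)) (u.map (label k P)) = some j then (1 : ℝ) else 0) *
        ∑ p with label k P p = j, ∑ q with label k P q = j,
          if BadPair P Q α p q then wt P p * wt Q q else 0 := by
  let I : List ℕ → List ℕ → ℝ := fun σ τ => if commonLabel G σ τ = some j then 1 else 0
  let K : List ℕ → ℝ := fun σ => listE (wt Q) N fun u => I σ (u.map (label k P))
  let H : Cube n → ℝ := fun p =>
    ∑ q, if label k P q = j then wt Q q * (if BadPair P Q α p q then 1 else 0) else 0
  have hI1 : ∀ σ τ, (if j ∈ τ then I σ τ else 0) = I σ τ := by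
    intro σ τ
    by_cases h : commonLabel G σ τ = some j
    · rw [if_pos (mem_of_commonLabel h).2.2]
    · simp [I, h]
  have hI2 : ∀ σ, (if j ∈ σ then K σ else 0) = K σ := by
    intro σ
    by_cases h : j ∈ σ
    · rw [if_pos h]
    · rw [if_neg h]
      refine ((listE_const (sum_wt Q) N 0).symm.trans ?_)
      simp only [K]
      congr 1
      funext u
      rw [eq_comm]
      exact if_neg fun h' => h (mem_of_commonLabel h').2.1
  have hinner : ∀ s : List (Cube n), listE (wt Q) N (fun u => (firstIn k P j s).elim 0 fun p =>
      (firstIn k P j u).elim 0 fun q => I (s.map (label k P)) (u.map (label k P)) *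
        if BadPair P Q α p q then 1 else 0) * labelWeight (wt Q) (label k P) j =
      (firstIn k P j s).elim 0 fun p => K (s.map (label k P)) * H p := by
    intro s
    cases firstIn k P j s with
    | none => simp [listE_const (sum_wt Q)]
    | some p =>
      have := listE_first (wt Q) (label k P) j N (I (s.map (label k P)))
        fun q => if BadPair P Q α p q then 1 else 0
      simp only [hI1] at this
      exact this
  have houter := listE_first (wt P) (label k P) j N K H
  simp only [hI2] at houter
  have hW : ∑ p, (if label k P p = j then wt P p * H p else 0) =
      ∑ p with label k P p = j, ∑ q with label k P q = j,
        if BadPair P Q α p q then wt P p * wt Q q else 0 := by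
    rw [Finset.sum_filter]
    refine Finset.sum_congr rfl fun p _ => ?_
    congr 1
    rw [Finset.mul_sum, Finset.sum_filter]
    refine Finset.sum_congr rfl fun q _ => ?_
    split_ifs <;> simp
  rw [← hW]
  refine Eq.trans ?_ houter
  rw [mul_comm (labelWeight (wt P) (label k P) j), ← mul_assoc]
  congr 1
  rw [mul_comm, ← listE_const_mul]
  congr 1
  funext s
  rw [mul_comm]
  exact hinner s

open Classical in
/-- If the samples are likely to hit a common far bucket, a round rejects with probability at least
`(ε₁ - α) / 10 - δ / (4 m t)`. -/
theorem insideRound_rejects {P Q : PMF (Cube n)} {k : ℕ} {ε ε₁ α δ : ℝ} {m t : ℕ}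
    (hx : 0 ≤ 2 * ε / (1 - ε)) (hxα : 2 * ε / (1 - ε) < α) (hα : α ≤ ε₁) (hm : 1 ≤ m) (ht : 1 ≤ t)
    (hδ : 0 < δ) (hδ1 : δ ≤ 1) (hk : 1 ≤ k)
    (hmass : √(k : ℝ) ≤ m * ∑ j ∈ farBuckets (wt P) (wt Q) (label k P) k ε₁,
      min (labelWeight (wt P) (label k P) j) (labelWeight (wt Q) (label k P) j)) :
    ev P Q (insideRound n k ε α δ m t) accVal ≤ 1 - (ε₁ - α) / 10 + δ / (4 * m * t) := by
  set G := farBuckets (wt P) (wt Q) (label k P) k ε₁ with hG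
  set φ := label k P with hφ
  have hm' : (0 : ℝ) < m := by exact_mod_cast hm
  have ht' : (0 : ℝ) < t := by exact_mod_cast ht
  set e := δ / (4 * m * t) with he
  have he0 : 0 ≤ e := by positivity
  have hGsub : G ⊆ Finset.Icc 1 k := Finset.filter_subset _ _
  have hcard : G.card ≤ k := (Finset.card_le_card hGsub).trans (by simp)
  have hcoll := listE_collision_ge (wt_nonneg P) (sum_wt P) (wt_nonneg Q) (sum_wt Q) φ m G hcard
    hmass hk
  let I : ℕ → List (Cube n) → List (Cube n) → ℝ := fun j s u =>
    if commonLabel G (s.map φ) (u.map φ) = some j then 1 else 0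
  -- The expectation of `X j` is the probability that `j` is the common label and that its first
  -- samples are a bad pair.
  let X : ℕ → List (Cube n) → List (Cube n) → ℝ := fun j s u =>
    (firstIn k P j s).elim 0 fun p => (firstIn k P j u).elim 0 fun q =>
      I j s u * if BadPair P Q α p q then 1 else 0
  have hXge : ∀ j ∈ G, (ε₁ - α) / 2 * listE (wt P) m (fun s => listE (wt Q) m fun u => I j s u) ≤
      listE (wt P) m fun s => listE (wt Q) m fun u => X j s u := by
    intro j hj
    obtain ⟨-, hp, hq, hE⟩ := Finset.mem_filter.1 hj
    have hbad := bad_pairs (S := Finset.univ.filter fun x => φ x = j) (P := wt P) (Q := wt Q)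
      (fun x _ => wt_nonneg P x) (fun x _ => wt_nonneg Q x)
      (by rwa [← labelWeight_eq_sum_filter]) (by rwa [← labelWeight_eq_sum_filter])
      (hx.trans hxα.le)
    rw [← labelWeight_eq_sum_filter (wt P), ← labelWeight_eq_sum_filter (wt Q)] at hbad
    rw [bucketExcess, ← hφ] at hE
    have hfirst := listE_bad_first P Q k α G j m
    rw [← hφ] at hfirst
    set p := labelWeight (wt P) φ j
    set q := labelWeight (wt Q) φ j
    have hI0 : 0 ≤ listE (wt P) m (fun s => listE (wt Q) m fun u => I j s u) :=
      listE_nonneg (wt_nonneg P) m fun s => listE_nonneg (wt_nonneg Q) m fun u => ite_mem_Icc.1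
    refine le_of_mul_le_mul_right (le_trans ?_ hfirst.ge) (mul_pos hp hq)
    have hlow : (ε₁ - α) / 2 * (p * q) ≤ ∑ a with φ a = j, ∑ b with φ b = j,
        if BadPair P Q α a b then wt P a * wt Q b else 0 := by
      refine le_trans ?_ hbad
      have := mul_le_mul_of_nonneg_right (sub_le_sub_right hE (α * p)) hq.le
      linarith
    have := mul_le_mul_of_nonneg_left hlow hI0
    linarith
  have hsumX : (ε₁ - α) / 10 ≤
      ∑ j ∈ G, listE (wt P) m fun s => listE (wt Q) m fun u => X j s u := by
    refine le_trans ?_ (Finset.sum_le_sum hXge)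
    rw [← Finset.mul_sum]
    have h1 : ∑ j ∈ G, listE (wt P) m (fun s => listE (wt Q) m fun u => I j s u) =
        listE (wt P) m fun s => listE (wt Q) m fun u =>
          if ∃ j ∈ G, j ∈ s.map φ ∧ j ∈ u.map φ then 1 else 0 := by
      rw [← listE_sum]
      congr 1
      funext s
      rw [← listE_sum]
      congr 1
      funext u
      exact sum_ite_commonLabel G _ _
    rw [h1]
    have := mul_le_mul_of_nonneg_left hcoll (show 0 ≤ (ε₁ - α) / 2 by linarith)
    linarith
  have hpoint : ∀ s u : List (Cube n), (∀ x ∈ u, 0 < wt Q x) →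
      (∏ j ∈ Finset.Icc 1 k, pairAcc P Q ε α δ m t (firstIn k P j s) (firstIn k P j u)) +
        ∑ j ∈ G, X j s u ≤ 1 + e := by
    intro s u hu
    have hQ : ∀ j q, firstIn k P j u = some q → 0 < wt Q q := fun j q h =>
      hu q (firstIn_eq_some h).1
    have hf0 : ∀ j, 0 ≤ pairAcc P Q ε α δ m t (firstIn k P j s) (firstIn k P j u) :=
      fun j => pairAcc_nonneg ..
    have hf1 : ∀ j, pairAcc P Q ε α δ m t (firstIn k P j s) (firstIn k P j u) ≤ 1 :=
      fun j => pairAcc_le_one (hQ j)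
    -- If there is a bad first pair at the common label, the one factor of this label is small.
    have hprod1 : ∏ j ∈ Finset.Icc 1 k,
        pairAcc P Q ε α δ m t (firstIn k P j s) (firstIn k P j u) ≤ 1 :=
      Finset.prod_le_one (fun j _ => hf0 j) fun j _ => hf1 j
    have hX0 : ∀ j, commonLabel G (s.map φ) (u.map φ) ≠ some j → X j s u = 0 := by
      intro j hj
      simp only [X, I, if_neg hj, zero_mul]
      cases firstIn k P j s <;> cases firstIn k P j u <;> rfl
    rcases hc : commonLabel G (s.map φ) (u.map φ) with _ | i
    · rw [Finset.sum_eq_zero fun j _ => hX0 j (by rw [hc]; simp)]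
      linarith
    · obtain ⟨hiG, his, hiu⟩ := mem_of_commonLabel hc
      rw [Finset.sum_eq_single i (fun j _ hj => hX0 j fun h => hj (by
        rw [hc] at h; exact (Option.some.inj h).symm)) fun h => absurd hiG h]
      obtain ⟨p, hp⟩ := exists_firstIn his
      obtain ⟨q, hq⟩ := exists_firstIn hiu
      have hXi : X i s u = if BadPair P Q α p q then 1 else 0 := by
        simp only [X, I, hp, hq, hc, Option.elim_some, if_true, one_mul]
      rw [hXi]
      split_ifs with hb
      · have hi1 := (Finset.mem_Icc.1 (hGsub hiG)).1
        have hle : ∏ j ∈ Finset.Icc 1 k,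
            pairAcc P Q ε α δ m t (firstIn k P j s) (firstIn k P j u) ≤
            pairAcc P Q ε α δ m t (firstIn k P i s) (firstIn k P i u) := by
          rw [← Finset.mul_prod_erase _ _ (hGsub hiG)]
          exact mul_le_of_le_one_right (hf0 i)
            (Finset.prod_le_one (fun j _ => hf0 j) fun j _ => hf1 j)
        rw [hp, hq] at hle
        have := pairTest_rejects hx hxα hm ht hδ hδ1
          (pos_of_bucketIndex (firstIn_eq_some hp).2 hi1)
          (pos_of_bucketIndex (firstIn_eq_some hq).2 hi1) (hQ i q hq) hb
        have hle' := hle.trans this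
        linarith
      · linarith
  rw [ev_insideRound_accVal]
  have htotal : listE (wt P) m (fun s => listE (wt Q) m fun u => ∏ j ∈ Finset.Icc 1 k,
        pairAcc P Q ε α δ m t (firstIn k P j s) (firstIn k P j u)) +
      ∑ j ∈ G, listE (wt P) m (fun s => listE (wt Q) m fun u => X j s u) ≤ 1 + e := by
    rw [← listE_sum]
    simp only [← listE_sum]
    rw [← listE_add]
    simp only [← listE_add]
    refine le_trans (listE_mono (wt_nonneg P) fun s _ _ =>
      listE_mono (wt_nonneg Q) fun u _ hu => hpoint s u hu) ?_
    rw [listE_const (sum_wt Q), listE_const (sum_wt P)]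
  linarith

end Round

/-! ### InsideBucket -/

section InsideBucket

/-- The margin by which `η` exceeds the distance that the closeness `ε` and the bucket distance
`ε₂` account for. -/
noncomputable def margin (η ε ε₂ : ℝ) : ℝ := 0.99 * η - 3.25 * ε₂ - 2 * ε / (1 - ε)

/-- The number of samples that a round of InsideBucket draws from each distribution. -/
noncomputable def roundSize (k : ℕ) (B : ℝ) : ℕ := ⌈√(k : ℝ) / (B / 21)⌉₊

/-- The number of rounds of InsideBucket. -/
noncomputable def numRounds (B δ : ℝ) : ℕ := ⌈Real.log (4 / δ) / -Real.log (1 - B / 21)⌉₊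

theorem insideBucket_eq (n k : ℕ) (ε ε₂ η δ : ℝ) :
    insideBucket n k ε ε₂ η δ = allAccept
      (fun _ : ℕ => insideRound n k ε (2 * ε / (1 - ε) + margin η ε ε₂ / 2.1) δ
        (roundSize k (margin η ε ε₂)) (numRounds (margin η ε ε₂) δ))
      (List.range (numRounds (margin η ε ε₂) δ)) := by
  have h1 : 0.99 * η - 3.25 * ε₂ - ((0.99 * η - 3.25 * ε₂ - 2 * ε / (1 - ε)) / 1.05 +
      2 * ε / (1 - ε)) = margin η ε ε₂ / 21 := by rw [margin]; ring
  have h2 : ((0.99 * η - 3.25 * ε₂ - 2 * ε / (1 - ε)) / 1.05 + 2 * ε / (1 - ε) +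
      2 * ε / (1 - ε)) / 2 = 2 * ε / (1 - ε) + margin η ε ε₂ / 2.1 := by rw [margin]; ring
  have h3 : 10 / (10 - ((0.99 * η - 3.25 * ε₂ - 2 * ε / (1 - ε)) / 1.05 + 2 * ε / (1 - ε)) +
      (2 * ε / (1 - ε) + margin η ε ε₂ / 2.1)) = (1 - margin η ε ε₂ / 21)⁻¹ := by
    rw [show 10 - ((0.99 * η - 3.25 * ε₂ - 2 * ε / (1 - ε)) / 1.05 + 2 * ε / (1 - ε)) +
      (2 * ε / (1 - ε) + margin η ε ε₂ / 2.1) = 10 * (1 - margin η ε ε₂ / 21) by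
        rw [margin]; ring, div_mul_eq_div_div, div_self (by norm_num), one_div]
  simp only [insideBucket, h1, h2, h3, Real.log_inv]
  rfl

variable {η ε ε₂ : ℝ}

theorem odds_le (hε : 0 ≤ ε) (hη1 : η ≤ 1) (hεη : ε < η / 11.6) :
    2 * ε / (1 - ε) ≤ 2.2 * ε := by
  have h : ε ≤ 1 / 11.6 := hεη.le.trans (by gcongr)
  rw [div_le_iff₀ (by norm_num at h ⊢; linarith)]
  norm_num at h ⊢
  nlinarith

theorem div_three_le_margin (hη1 : η ≤ 1) (hε : 0 ≤ ε) (hεη : ε < η / 11.6)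
    (hε₂ : ε₂ ≤ ε / 2 + η / 10) : η / 3 ≤ margin η ε ε₂ := by
  have h := odds_le hε hη1 hεη
  rw [lt_div_iff₀ (by norm_num)] at hεη
  rw [margin]
  linarith

theorem margin_lt_one (hη1 : η ≤ 1) (hε : 0 ≤ ε) (hεη : ε < η / 11.6) (hε₂ : 0 ≤ ε₂) :
    margin η ε ε₂ < 1 := by
  rw [lt_div_iff₀ (by norm_num)] at hεη
  have : 0 ≤ 2 * ε / (1 - ε) := div_nonneg (by linarith) (by linarith)
  rw [margin]
  linarith

theorem one_le_roundSize {k : ℕ} {B : ℝ} (hk : 1 ≤ k) (hB : 0 < B) : 1 ≤ roundSize k B := by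
  have hk' : (0 : ℝ) < k := by exact_mod_cast hk
  exact Nat.one_le_ceil_iff.2 (by positivity)

theorem neg_log_pos {B : ℝ} (hB : 0 < B) (hB1 : B < 1) : 0 < -Real.log (1 - B / 21) :=
  neg_pos.2 (Real.log_neg (by linarith) (by linarith))

theorem one_le_numRounds {B δ : ℝ} (hB : 0 < B) (hB1 : B < 1) (hδ : 0 < δ) (hδ1 : δ ≤ 1) :
    1 ≤ numRounds B δ := by
  have : 0 < Real.log (4 / δ) := Real.log_pos (by rw [lt_div_iff₀ hδ]; linarith)
  exact Nat.one_le_ceil_iff.2 (div_pos this (neg_log_pos hB hB1))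

theorem pow_numRounds_le {B δ : ℝ} (hB : 0 < B) (hB1 : B < 1) (hδ : 0 < δ) :
    (1 - B / 21) ^ numRounds B δ ≤ δ / 4 := by
  have h := Nat.le_ceil (Real.log (4 / δ) / -Real.log (1 - B / 21))
  rw [div_le_iff₀ (neg_log_pos hB hB1)] at h
  have hpos : 0 < 1 - B / 21 := by linarith
  rw [← Real.exp_log hpos, ← Real.exp_nat_mul,
    ← Real.exp_log (show 0 < δ / 4 by positivity), Real.exp_le_exp,
    show δ / 4 = (4 / δ)⁻¹ by rw [inv_div], Real.log_inv, numRounds]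
  linarith

theorem pow_le_pow_add_mul {a c e : ℝ} (ha : 0 ≤ a) (ha1 : a ≤ 1) (hc : 0 ≤ c) (hc1 : c ≤ 1)
    (he : 0 ≤ e) (h : a ≤ c + e) (t : ℕ) : a ^ t ≤ c ^ t + t * e := by
  induction t with
  | zero => simp
  | succ t ih =>
    have h1 : c ^ t ≤ 1 := pow_le_one₀ hc hc1
    have h2 : 0 ≤ c ^ t := pow_nonneg hc t
    have h3 : (0 : ℝ) ≤ t * e := by positivity
    rw [pow_succ', pow_succ']
    push_cast
    calc a * a ^ t ≤ a * (c ^ t + t * e) := mul_le_mul_of_nonneg_left ih ha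
      _ = a * c ^ t + a * (t * e) := by ring
      _ ≤ (c + e) * c ^ t + 1 * (t * e) := by gcongr
      _ ≤ _ := by nlinarith

variable {n : ℕ}

theorem ev_insideBucket_accVal (P Q : PMF (Cube n)) (k : ℕ) (ε ε₂ η δ : ℝ) :
    ev P Q (insideBucket n k ε ε₂ η δ) accVal =
      ev P Q (insideRound n k ε (2 * ε / (1 - ε) + margin η ε ε₂ / 2.1) δ
        (roundSize k (margin η ε ε₂)) (numRounds (margin η ε ε₂) δ)) accVal ^
          numRounds (margin η ε ε₂) δ := by
  rw [insideBucket_eq, ev_allAccept_accVal]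
  simp

theorem ev_insideBucket_one (P Q : PMF (Cube n)) (k : ℕ) (ε ε₂ η δ : ℝ) :
    ev P Q (insideBucket n k ε ε₂ η δ) (fun _ => 1) = 1 := by
  rw [insideBucket_eq]
  exact ev_allAccept_one P Q fun _ _ => ev_insideRound_one ..

theorem insideBucket_accepts {P Q : PMF (Cube n)} {k : ℕ} {δ : ℝ} (hη : 0 < η) (hη1 : η ≤ 1)
    (hε : 0 ≤ ε) (hεη : ε < η / 11.6) (hε₂0 : 0 ≤ ε₂) (hε₂ : ε₂ ≤ ε / 2 + η / 10) (hδ : 0 < δ)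
    (hδ1 : δ ≤ 1) (hk : 1 ≤ k) (hlow : ∀ x, (1 - ε) * wt P x ≤ wt Q x)
    (hup : ∀ x, wt Q x ≤ (1 + ε) * wt P x) :
    1 - δ / 4 ≤ ev P Q (insideBucket n k ε ε₂ η δ) accVal := by
  rw [ev_insideBucket_accVal]
  have hB := div_three_le_margin hη1 hε hεη hε₂
  have hB1 := margin_lt_one hη1 hε hεη hε₂0
  set B := margin η ε ε₂
  have hB0 : 0 < B := by linarith
  have ht := one_le_numRounds hB0 hB1 hδ hδ1
  set t := numRounds B δ
  have ht' : (1 : ℝ) ≤ t := by exact_mod_cast ht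
  have hε1 : ε < 1 := by
    rw [lt_div_iff₀ (by norm_num)] at hεη
    linarith
  have h := insideRound_accepts (k := k) hε hε1 (α := 2 * ε / (1 - ε) + B / 2.1)
    (by linarith [show 0 < B / 2.1 by positivity]) (one_le_roundSize hk hB0) ht hδ hδ1 hlow hup
  have hdt : δ / (4 * t) ≤ 1 := by
    rw [div_le_one (by positivity)]
    linarith
  have hbern := one_add_mul_le_pow (a := -(δ / (4 * t))) (by linarith) t
  calc 1 - δ / 4 = 1 + t * -(δ / (4 * t)) := by field_simp; ring
    _ ≤ (1 + -(δ / (4 * t))) ^ t := hbern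
    _ ≤ _ := pow_le_pow_left₀ (by linarith) (by linarith) t

theorem insideBucket_rejects {P Q : PMF (Cube n)} {k : ℕ} {δ : ℝ} (hη : 0 < η) (hη1 : η ≤ 1)
    (hε : 0 ≤ ε) (hεη : ε < η / 11.6) (hε₂0 : 0 ≤ ε₂) (hε₂ : ε₂ ≤ ε / 2 + η / 10) (hδ : 0 < δ)
    (hδ1 : δ ≤ 1) (hk : k = n + ⌈Real.logb 2 (100 / η)⌉₊) (hk1 : 1 ≤ k)
    (hfar : η < dTV P Q) (hd : bucketTV k P Q ≤ ε₂) :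
    ev P Q (insideBucket n k ε ε₂ η δ) accVal ≤ δ / 2 := by
  rw [ev_insideBucket_accVal]
  have hB := div_three_le_margin hη1 hε hεη hε₂
  have hB1 := margin_lt_one hη1 hε hεη hε₂0
  have hBdef : margin η ε ε₂ = 0.99 * η - 3.25 * ε₂ - 2 * ε / (1 - ε) := rfl
  set B := margin η ε ε₂
  have hB0 : 0 < B := by linarith
  have ht := one_le_numRounds hB0 hB1 hδ hδ1
  have hpow := pow_numRounds_le hB0 hB1 hδ
  set t := numRounds B δ
  have hm := one_le_roundSize (B := B) hk1 hB0
  have hmle : √(k : ℝ) / (B / 21) ≤ roundSize k B := Nat.le_ceil _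
  set m := roundSize k B
  have ht' : (1 : ℝ) ≤ t := by exact_mod_cast ht
  have hm' : (1 : ℝ) ≤ m := by exact_mod_cast hm
  have hε1 : ε < 1 := by
    rw [lt_div_iff₀ (by norm_num)] at hεη
    linarith
  have hx : 0 ≤ 2 * ε / (1 - ε) := div_nonneg (by linarith) (by linarith)
  have hmass := le_sum_min_farBuckets (wt_nonneg P) (sum_wt P) (wt_nonneg Q) (sum_wt Q)
    (φ := label k P) (fun x => bucketIndex_le _ _) (labelWeight_zero_le P hη hk)
    (ε := B / 1.05 + 2 * ε / (1 - ε)) (by positivity) hfar.le rfl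
  change _ - 2 * bucketTV k P Q - _ ≤ _ at hmass
  have hmass' : √(k : ℝ) ≤ m * ∑ j ∈ farBuckets (wt P) (wt Q) (label k P) k
      (B / 1.05 + 2 * ε / (1 - ε)),
      min (labelWeight (wt P) (label k P) j) (labelWeight (wt Q) (label k P) j) := by
    rw [div_le_iff₀ (by positivity)] at hmle
    refine hmle.trans (mul_le_mul_of_nonneg_left (le_trans ?_ hmass) (by linarith))
    have : B / 21 = 0.99 * η - 3.25 * ε₂ - (B / 1.05 + 2 * ε / (1 - ε)) := by
      rw [hBdef]; ring
    linarith
  have hround := insideRound_rejects (P := P) (Q := Q) hx (α := 2 * ε / (1 - ε) + B / 2.1)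
    (by linarith [show 0 < B / 2.1 by positivity])
    (by
      have : B / 2.1 ≤ B / 1.05 := by gcongr; norm_num
      linarith) hm ht hδ hδ1 hk1 hmass'
  have hgap : (B / 1.05 + 2 * ε / (1 - ε) - (2 * ε / (1 - ε) + B / 2.1)) / 10 = B / 21 := by ring
  rw [hgap] at hround
  have h0 := ev_nonneg P Q (insideRound n k ε (2 * ε / (1 - ε) + B / 2.1) δ m t) accVal_nonneg
  have h1 := (ev_mono P Q (insideRound n k ε (2 * ε / (1 - ε) + B / 2.1) δ m t)
    accVal_le_one).trans_eq (ev_insideRound_one P Q k ε _ δ m t)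
  have h2 := pow_le_pow_add_mul h0 h1 (by linarith) (by linarith)
    (show 0 ≤ δ / (4 * m * t) by positivity) hround t
  have h3 : (t : ℝ) * (δ / (4 * m * t)) ≤ δ / 4 := by
    rw [show (t : ℝ) * (δ / (4 * m * t)) = δ / 4 / m by field_simp]
    exact div_le_self (by positivity) hm'
  linarith

end InsideBucket

/-! ### Correctness of the tester -/

section Correctness

variable {n : ℕ}

theorem wt_bounds_of_dInf_le {P Q : PMF (Cube n)} {ε : ℝ} (hε : 0 ≤ ε)
    (h : dInf P Q ≤ ENNReal.ofReal ε) (x : Cube n) :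
    (1 - ε) * wt P x ≤ wt Q x ∧ wt Q x ≤ (1 + ε) * wt P x := by
  have hx := (le_iSup _ x).trans h
  by_cases hP : P x = 0
  · rw [if_pos hP] at hx
    by_cases hQ : Q x = 0
    · simp [wt, hP, hQ]
    · rw [if_neg hQ] at hx
      exact absurd hx (by simp)
  · rw [if_neg hP, ENNReal.ofReal_le_ofReal_iff hε] at hx
    have hpos : 0 < wt P x := ENNReal.toReal_pos hP (P.apply_ne_top x)
    change |wt Q x / wt P x - 1| ≤ ε at hx
    rw [abs_le] at hx
    have h1 : 1 - ε ≤ wt Q x / wt P x := by linarith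
    have h2 : wt Q x / wt P x ≤ 1 + ε := by linarith
    exact ⟨(le_div_iff₀ hpos).1 h1, (div_le_iff₀ hpos).1 h2⟩

theorem bucketTV_le {P Q : PMF (Cube n)} {ε : ℝ} (k : ℕ)
    (hlow : ∀ x, (1 - ε) * wt P x ≤ wt Q x) (hup : ∀ x, wt Q x ≤ (1 + ε) * wt P x) :
    bucketTV k P Q ≤ ε / 2 := by
  have h1 : ∑ i ∈ Finset.range (k + 1),
      |labelWeight (wt P) (label k P) i - labelWeight (wt Q) (label k P) i| ≤
      ∑ i ∈ Finset.range (k + 1), ε * labelWeight (wt P) (label k P) i := by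
    refine Finset.sum_le_sum fun i _ => ?_
    rw [labelWeight, labelWeight, ← Finset.sum_sub_distrib, Finset.mul_sum]
    refine (Finset.abs_sum_le_sum_abs _ _).trans (Finset.sum_le_sum fun x _ => ?_)
    split_ifs
    · rw [abs_le]
      constructor <;> linarith [hlow x, hup x]
    · simp
  rw [← Finset.mul_sum, sum_range_labelWeight (φ := label k P) (sum_wt P)
    fun x => bucketIndex_le _ _] at h1
  rw [bucketTV]
  linarith

theorem empiricalTV_nonneg (k N : ℕ) (s t : List ℕ) : 0 ≤ empiricalTV k N s t :=
  mul_nonneg one_half_pos.le (Finset.sum_nonneg fun _ _ => abs_nonneg _)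

theorem ev_outsideBucket_mono {k : ℕ} {θ δ : ℝ} {P Q : PMF (Cube n)} {g h : ℝ → ℝ}
    (hgh : ∀ d, 0 ≤ d → g d ≤ h d) :
    ev P Q (outsideBucket (sampBP n k) (sampBQ n k) k θ δ) g ≤
      ev P Q (outsideBucket (sampBP n k) (sampBQ n k) k θ δ) h := by
  obtain ⟨N, -, -, hN⟩ := ev_outsideBucket k θ δ P Q
  rw [hN, hN]
  exact listE_mono (wt_nonneg P) fun s _ _ => listE_mono (wt_nonneg Q) fun t _ _ =>
    hgh _ (empiricalTV_nonneg ..)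

theorem one_le_bucketCount {η : ℝ} (n : ℕ) (hη : 0 < η) (hη1 : η ≤ 1) :
    1 ≤ n + ⌈Real.logb 2 (100 / η)⌉₊ := by
  refine le_add_left (Nat.one_le_ceil_iff.2 (Real.logb_pos one_lt_two ?_))
  rw [lt_div_iff₀ hη]
  linarith

open Classical in
/-- If, with an estimate within `θ` of the bucket distance, the rest of the tester gives the
verdict measured by `val` with probability at least `1 - δ / 4`, then the tester gives it with
probability at least `1 - δ / 2`. -/
theorem one_sub_le_ev_barbarik3 {η ε δ : ℝ} (hη : 0 < η) (hδ : 0 < δ) (hδ1 : δ ≤ 1)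
    {P Q : PMF (Cube n)} {val : Verdict → ℝ} (hval : ∀ v, 0 ≤ val v)
    (h : ∀ d, 0 ≤ d → |d - bucketTV (n + ⌈Real.logb 2 (100 / η)⌉₊) P Q| ≤ η / 20 →
      1 - δ / 4 ≤ if ε / 2 + η / 20 < d then val Verdict.reject else
        ev P Q (insideBucket n (n + ⌈Real.logb 2 (100 / η)⌉₊) ε (d + η / 20) η (δ / 2)) val) :
    1 - δ ≤ ev P Q (barbarik3 n η ε δ) val := by
  set k := n + ⌈Real.logb 2 (100 / η)⌉₊ with hk
  have hacc := outsideBucket_accurate k (θ := η / 20) (δ := δ / 2) (by positivity) (by positivity)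
    (by linarith) P Q
  have hbind : ev P Q (barbarik3 n η ε δ) val =
      ev P Q (outsideBucket (sampBP n k) (sampBQ n k) k (η / 20) (δ / 2)) fun d =>
        if ε / 2 + η / 20 < d then val Verdict.reject else
          ev P Q (insideBucket n k ε (d + η / 20) η (δ / 2)) val := by
    unfold barbarik3
    simp only [ev_bind, ← hk]
    congr 1
    funext d
    split_ifs <;> rfl
  rw [hbind]
  have hmono := ev_outsideBucket_mono (k := k) (θ := η / 20) (δ := δ / 2) (P := P) (Q := Q)
    (g := fun _ => 1 - δ / 4) (h := fun d =>
      (if ε / 2 + η / 20 < d then val Verdict.reject else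
          ev P Q (insideBucket n k ε (d + η / 20) η (δ / 2)) val) +
      if η / 20 < |d - bucketTV k P Q| then 1 else 0) (fun d hd => by
        by_cases hb : η / 20 < |d - bucketTV k P Q|
        · have : 0 ≤ if ε / 2 + η / 20 < d then val Verdict.reject else
              ev P Q (insideBucket n k ε (d + η / 20) η (δ / 2)) val := by
            split_ifs
            exacts [hval _, ev_nonneg P Q _ hval]
          simp only [if_pos hb]
          linarith
        · have := h d hd (not_lt.1 hb)
          simp only [if_neg hb, add_zero]
          exact this)
  rw [ev_outsideBucket_const, ev_add] at hmono
  linarith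

theorem barbarik3_accepts {η ε δ : ℝ} (hη : 0 < η) (hη1 : η ≤ 1) (hε : 0 ≤ ε)
    (hεη : ε < η / 11.6) (hδ : 0 < δ) (hδ1 : δ ≤ 1) {P Q : PMF (Cube n)}
    (h : dInf P Q ≤ ENNReal.ofReal ε) : 1 - δ ≤ ev P Q (barbarik3 n η ε δ) accVal := by
  have hlow := fun x => (wt_bounds_of_dInf_le hε h x).1
  have hup := fun x => (wt_bounds_of_dInf_le hε h x).2
  refine one_sub_le_ev_barbarik3 hη hδ hδ1 accVal_nonneg fun d hd hdist => ?_
  have hTV := bucketTV_le (n + ⌈Real.logb 2 (100 / η)⌉₊) hlow hup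
  have hd1 : d ≤ ε / 2 + η / 20 := by linarith [(abs_le.1 hdist).2]
  rw [if_neg (not_lt.2 hd1)]
  have := insideBucket_accepts (k := n + ⌈Real.logb 2 (100 / η)⌉₊) (ε₂ := d + η / 20) hη hη1 hε hεη
    (by linarith) (by linarith) (half_pos hδ) (by linarith) (one_le_bucketCount n hη hη1) hlow hup
  linarith

theorem barbarik3_rejects {η ε δ : ℝ} (hη : 0 < η) (hη1 : η ≤ 1) (hε : 0 ≤ ε)
    (hεη : ε < η / 11.6) (hδ : 0 < δ) (hδ1 : δ ≤ 1) {P Q : PMF (Cube n)}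
    (h : η < dTV P Q) : 1 - δ ≤ ev P Q (barbarik3 n η ε δ) rejVal := by
  refine one_sub_le_ev_barbarik3 hη hδ hδ1 (fun v => by cases v <;> simp [rejVal])
    fun d hd hdist => ?_
  split_ifs with hd1
  · simp only [rejVal]
    linarith
  · have hacc := insideBucket_rejects (k := n + ⌈Real.logb 2 (100 / η)⌉₊) (ε₂ := d + η / 20)
      hη hη1 hε hεη (by linarith) (by linarith) (half_pos hδ) (by linarith) rfl
      (one_le_bucketCount n hη hη1) h (by linarith [(abs_le.1 hdist).1])
    have := ev_accVal_add_rejVal P Q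
      (insideBucket n (n + ⌈Real.logb 2 (100 / η)⌉₊) ε (d + η / 20) η (δ / 2))
    rw [ev_insideBucket_one] at this
    linarith

end Correctness

/-! ### The number of queries -/

section QueryCount

variable {n : ℕ}

theorem queryBound_drawP : QueryBound (drawP n) 2 fun _ => True :=
  ⟨by norm_num, fun _ => ⟨by norm_num, fun _ => trivial⟩⟩

theorem queryBound_drawQ : QueryBound (drawQ n) 2 fun _ => True :=
  ⟨by norm_num, fun _ => ⟨by norm_num, fun _ => trivial⟩⟩

theorem queryBound_sampBP (k : ℕ) : QueryBound (sampBP n k) 2 fun _ => True :=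
  queryBound_drawP.bind (c := 0) fun _ _ => trivial

theorem queryBound_sampBQ (k : ℕ) : QueryBound (sampBQ n k) 2 fun _ => True :=
  queryBound_drawQ.bind (c := 0) fun _ _ => trivial

theorem queryBound_outsideBucket {D₁ D₂ : OracleProg n ℕ} {b : ℕ}
    (h₁ : QueryBound D₁ b fun _ => True) (h₂ : QueryBound D₂ b fun _ => True) (k : ℕ) (θ δ : ℝ) :
    QueryBound (outsideBucket D₁ D₂ k θ δ)
      (⌈max (4 * ((k : ℝ) + 1) / θ ^ 2) (8 * Real.log (4 / δ) / θ ^ 2)⌉₊ * b +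
        ⌈max (4 * ((k : ℝ) + 1) / θ ^ 2) (8 * Real.log (4 / δ) / θ ^ 2)⌉₊ * b)
      fun d => 0 ≤ d :=
  (h₁.repeatN _).bind fun s _ => (h₂.repeatN _).bind (c := 0) fun t _ =>
    empiricalTV_nonneg k _ s t

theorem queryBound_bias (p q : Cube n) (r : ℕ) : QueryBound (bias p q r) r fun _ => True := by
  unfold bias
  split_ifs with h
  · trivial
  · have h1 : QueryBound (pcondQ p q h ret) 1 fun _ => True := ⟨le_rfl, fun _ => trivial⟩
    have h2 := (h1.repeatN r).bind (c := 0) (f := fun l => (pure ((l.count p : ℝ) / r) :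
      OracleProg n ℝ)) (J := fun _ => True) fun _ _ => trivial
    rwa [mul_one, add_zero] at h2

/-- The thresholds `h` and `l` of a pair in a common bucket are well separated. -/
theorem threshold_gap {p q x α : ℝ} (hp : 0 < p) (hq : 0 < q) (hpq : p ≤ 2 * q) (hqp : q ≤ 2 * p)
    (hx : 0 ≤ x) (hxα : x ≤ α) (hα1 : α ≤ 1) :
    (α - x) / 50 ≤ p / (p + q * (1 + x)) - p / (p + q * (1 + α)) := by
  have hα : 0 ≤ α := hx.trans hxα
  -- Both denominators are at most `p + 2 q ≤ 5 p`, because `1 + α ≤ 2`.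
  have h1 : p + q * (1 + x) ≤ 5 * p := by nlinarith
  have h2 : p + q * (1 + α) ≤ 5 * p := by nlinarith
  have h1' : 0 < p + q * (1 + x) := by positivity
  have h2' : 0 < p + q * (1 + α) := by positivity
  rw [div_sub_div _ _ h1'.ne' h2'.ne', div_le_div_iff₀ (by norm_num) (mul_pos h1' h2')]
  have h3 : (p + q * (1 + x)) * (p + q * (1 + α)) ≤ 5 * p * (5 * p) :=
    mul_le_mul h1 h2 h2'.le (by positivity)
  have h4 : 5 * p * (5 * p) ≤ 50 * (p * q) := by nlinarith
  have h5 := mul_le_mul_of_nonneg_left (h3.trans h4) (sub_nonneg.2 hxα)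
  linarith

theorem queryBound_pairTest {k j : ℕ} {ε α δ : ℝ} {m t : ℕ} {p q : Cube n × ℝ} (hj : 1 ≤ j)
    (hp : bucketIndex k p.2 = j) (hq : bucketIndex k q.2 = j) (hx : 0 ≤ 2 * ε / (1 - ε))
    (hxα : 2 * ε / (1 - ε) < α) (hα1 : α ≤ 1) (hlog : 0 ≤ Real.log (4 * m * t / δ)) :
    QueryBound (pairTest ε α δ m t p q)
      ⌈2 * Real.log (4 * m * t / δ) / ((α - 2 * ε / (1 - ε)) / 50) ^ 2⌉₊ fun _ => True := by
  unfold pairTest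
  refine QueryBound.mono (QueryBound.bind (c := 0) (J := fun _ => True)
    (queryBound_bias p.1 q.1 _) fun _ _ => ?_) ?_ fun _ h => h
  · trivial
  rw [add_zero]
  have hgap := threshold_gap (pos_of_bucketIndex hp hj) (pos_of_bucketIndex hq hj)
    (le_two_mul_of_bucketIndex hp hq hj) (le_two_mul_of_bucketIndex hq hp hj) hx hxα.le hα1
  have hpos : 0 < (α - 2 * ε / (1 - ε)) / 50 := div_pos (sub_pos.2 hxα) (by norm_num)
  refine Nat.ceil_le_ceil (div_le_div_of_nonneg_left (by positivity) (by positivity) ?_)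
  exact pow_le_pow_left₀ hpos.le hgap 2

/-- A round tests at most as many pairs as it draws samples. -/
theorem queryBound_insideRound {ε α δ : ℝ} {m t : ℕ} (k : ℕ) (hx : 0 ≤ 2 * ε / (1 - ε))
    (hxα : 2 * ε / (1 - ε) < α) (hα1 : α ≤ 1) (hlog : 0 ≤ Real.log (4 * m * t / δ)) :
    QueryBound (insideRound n k ε α δ m t) (m * 2 + (m * 2 +
      m * ⌈2 * Real.log (4 * m * t / δ) / ((α - 2 * ε / (1 - ε)) / 50) ^ 2⌉₊)) fun _ => True := by
  set R := ⌈2 * Real.log (4 * m * t / δ) / ((α - 2 * ε / (1 - ε)) / 50) ^ 2⌉₊ with hR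
  refine (queryBound_drawP.repeatN m).bind fun gP hgP =>
    (queryBound_drawQ.repeatN m).bind fun gQ _ => ?_
  refine (QueryBound.allAccept (cost := fun j =>
    if j ∈ gP.map (fun x => bucketIndex k x.2) then R else 0) fun j hj => ?_).mono ?_ fun _ h => h
  · have hj1 : 1 ≤ j := (List.mem_range'_1.1 hj).1
    rcases hp : gP.find? (fun x => bucketIndex k x.2 == j) with _ | p <;>
      rcases hq : gQ.find? (fun x => bucketIndex k x.2 == j) with _ | q <;>
      simp only [hp, hq]
    · trivial
    · trivial
    · trivial
    have hpj : bucketIndex k p.2 = j := by simpa using List.find?_some hp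
    have hqj : bucketIndex k q.2 = j := by simpa using List.find?_some hq
    rw [if_pos (List.mem_map.2 ⟨p, List.mem_of_find?_eq_some hp, hpj⟩)]
    exact queryBound_pairTest hj1 hpj hqj hx hxα hα1 hlog
  · refine le_trans (le_of_eq ?_)
      ((sum_Icc_ite_mem_le k (gP.map fun x => bucketIndex k x.2) R).trans (le_of_eq ?_))
    · rfl
    · rw [List.length_map, hgP]

theorem queryBound_insideBucket {η ε ε₂ δ : ℝ} {k : ℕ} (hx : 0 ≤ 2 * ε / (1 - ε))
    (hB : 0 < margin η ε ε₂) (hα1 : 2 * ε / (1 - ε) + margin η ε ε₂ / 2.1 ≤ 1)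
    (hlog : 0 ≤ Real.log (4 * roundSize k (margin η ε ε₂) *
      numRounds (margin η ε ε₂) δ / δ)) :
    QueryBound (insideBucket n k ε ε₂ η δ)
      (numRounds (margin η ε ε₂) δ * (roundSize k (margin η ε ε₂) *
        (4 + ⌈2 * Real.log (4 * roundSize k (margin η ε ε₂) *
          numRounds (margin η ε ε₂) δ / δ) / (margin η ε ε₂ / 105) ^ 2⌉₊))) fun _ => True := by
  rw [insideBucket_eq]
  set B := margin η ε ε₂
  have hround := queryBound_insideRound (n := n) (δ := δ) (m := roundSize k B) (t := numRounds B δ)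
    k hx (α := 2 * ε / (1 - ε) + B / 2.1) (by linarith [show 0 < B / 2.1 by positivity]) hα1 hlog
  rw [show (2 * ε / (1 - ε) + B / 2.1 - 2 * ε / (1 - ε)) / 50 = B / 105 by ring] at hround
  refine (QueryBound.allAccept fun _ _ => hround).mono (le_of_eq ?_) fun _ h => h
  rw [List.map_const', List.sum_replicate, List.length_range, smul_eq_mul]
  ring

end QueryCount

/-! ### Estimates of the query bound -/

section Estimates

variable {n k : ℕ} {η δ B : ℝ}

theorem one_le_one_add_log (h0 : 0 < η) (h1 : η ≤ 1) : 1 ≤ 1 + Real.log (1 / η) := by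
  have : 0 ≤ Real.log (1 / η) := Real.log_nonneg (by rwa [le_div_iff₀ h0, one_mul])
  linarith

theorem log_eight_div_le (hδ : 0 < δ) (hδ1 : δ ≤ 1) :
    Real.log (4 / (δ / 2)) ≤ 3 * (1 + Real.log (1 / δ)) := by
  have h1 : Real.log (4 / (δ / 2)) = 3 * Real.log 2 + Real.log (1 / δ) := by
    rw [show 4 / (δ / 2) = 2 ^ 3 * (1 / δ) by field_simp; norm_num,
      Real.log_mul (by norm_num) (by positivity), Real.log_pow]
    norm_num
  have := Real.log_two_lt_d9
  have := one_le_one_add_log hδ hδ1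
  linarith

theorem bucketCount_le (hn : 2 ≤ n) (hη : 0 < η) (hη1 : η ≤ 1) :
    ((n + ⌈Real.logb 2 (100 / η)⌉₊ : ℕ) : ℝ) ≤ 6 * n * (1 + Real.log (1 / η)) := by
  have hL := one_le_one_add_log hη hη1
  have h100 : 0 ≤ Real.logb 2 (100 / η) :=
    Real.logb_nonneg one_lt_two (by rw [le_div_iff₀ hη]; linarith)
  have h1 := (Nat.ceil_lt_add_one h100).le
  have h2 : Real.logb 2 (100 / η) ≤ 9 * (1 + Real.log (1 / η)) := by
    rw [Real.logb, div_le_iff₀ (Real.log_pos one_lt_two)]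
    have h3 : Real.log (100 / η) ≤ 7 * Real.log 2 + Real.log (1 / η) := by
      rw [show 7 * Real.log 2 = Real.log (2 ^ 7) by rw [Real.log_pow]; norm_num,
        ← Real.log_mul (by norm_num) (by positivity)]
      apply Real.log_le_log (by positivity)
      rw [mul_one_div]
      gcongr
      norm_num
    have := Real.log_two_gt_d9
    have := Real.log_two_lt_d9
    nlinarith
  have hn' : (2 : ℝ) ≤ n := by exact_mod_cast hn
  push_cast
  nlinarith

theorem outside_estimate (hn : 2 ≤ n) (hη : 0 < η) (hη1 : η ≤ 1) (hδ : 0 < δ) (hδ1 : δ ≤ 1)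
    (hk : (k : ℝ) ≤ 6 * n * (1 + Real.log (1 / η))) :
    (⌈max (4 * ((k : ℝ) + 1) / (η / 20) ^ 2)
      (8 * Real.log (4 / (δ / 2)) / (η / 20) ^ 2)⌉₊ : ℝ) ≤
      20000 * ((1 + Real.log (1 / η)) * (1 + Real.log (1 / δ))) * (n / η ^ 2) := by
  have hL := one_le_one_add_log hη hη1
  have hD := one_le_one_add_log hδ hδ1
  have h8 := log_eight_div_le hδ hδ1
  set L := 1 + Real.log (1 / η)
  set D := 1 + Real.log (1 / δ)
  have hn' : (2 : ℝ) ≤ n := by exact_mod_cast hn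
  have hη2 : 0 < η ^ 2 := by positivity
  have hlog : 0 ≤ Real.log (4 / (δ / 2)) :=
    Real.log_nonneg (by rw [le_div_iff₀ (by positivity)]; linarith)
  have hLD : 1 ≤ L * D := one_le_mul_of_one_le_of_one_le hL hD
  have hLLD : L ≤ L * D := le_mul_of_one_le_right (by linarith) hD
  have hDLD : D ≤ L * D := le_mul_of_one_le_left (by linarith) hL
  have hnLD : 2 * (L * D) ≤ n * (L * D) := mul_le_mul_of_nonneg_right hn' (by linarith)
  have hnL : n * L ≤ n * (L * D) := mul_le_mul_of_nonneg_left hLLD (by linarith)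
  have h1 : max (4 * ((k : ℝ) + 1) / (η / 20) ^ 2) (8 * Real.log (4 / (δ / 2)) / (η / 20) ^ 2) ≤
      10400 * (n * (L * D)) / η ^ 2 := by
    refine max_le ?_ ?_
    · rw [div_pow, div_div_eq_mul_div]
      exact div_le_div_of_nonneg_right (by linarith) hη2.le
    · rw [div_pow, div_div_eq_mul_div]
      exact div_le_div_of_nonneg_right (by linarith) hη2.le
  have h2 : 1 ≤ n * (L * D) / η ^ 2 := by
    rw [le_div_iff₀ hη2]
    nlinarith
  have h3 := (Nat.ceil_lt_add_one (show 0 ≤ max (4 * ((k : ℝ) + 1) / (η / 20) ^ 2)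
    (8 * Real.log (4 / (δ / 2)) / (η / 20) ^ 2) from le_max_of_le_left (by positivity))).le
  have h4 : 10400 * (n * (L * D)) / η ^ 2 = 10400 * (n * (L * D) / η ^ 2) := by ring
  have h5 : 20000 * (L * D) * (n / η ^ 2) = 20000 * (n * (L * D) / η ^ 2) := by ring
  linarith

theorem roundSize_le (hn : 2 ≤ n) (hη : 0 < η) (hη1 : η ≤ 1) (hk1 : 1 ≤ k)
    (hk : (k : ℝ) ≤ 6 * n * (1 + Real.log (1 / η))) (hB : η / 3 ≤ B) :
    (roundSize k B : ℝ) ≤ 192 * (√(n : ℝ) * (1 + Real.log (1 / η)) / η) := by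
  have hL := one_le_one_add_log hη hη1
  set L := 1 + Real.log (1 / η)
  have hB0 : 0 < B := by linarith
  have hk1' : (1 : ℝ) ≤ k := by exact_mod_cast hk1
  have hsk : √(k : ℝ) ≤ 3 * (√(n : ℝ) * L) := by
    rw [Real.sqrt_le_iff]
    refine ⟨by positivity, hk.trans ?_⟩
    rw [mul_pow, mul_pow, Real.sq_sqrt n.cast_nonneg]
    have hn' : (2 : ℝ) ≤ n := by exact_mod_cast hn
    have : L ≤ L ^ 2 := by nlinarith
    have := mul_le_mul_of_nonneg_left this n.cast_nonneg (α := ℝ)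
    nlinarith
  have h1 : 1 ≤ √(k : ℝ) := Real.one_le_sqrt.2 hk1'
  have h2 : √(k : ℝ) / (B / 21) ≤ 63 * (√(k : ℝ) / η) := by
    rw [show 63 * (√(k : ℝ) / η) = √(k : ℝ) / (η / 63) by field_simp]
    exact div_le_div_of_nonneg_left (by positivity) (by positivity) (by linarith)
  have h3 : 1 ≤ √(k : ℝ) / η := by
    rw [le_div_iff₀ hη]
    linarith
  have h4 := (Nat.ceil_lt_add_one (show 0 ≤ √(k : ℝ) / (B / 21) by positivity)).le
  have h5 : √(k : ℝ) / η ≤ 3 * (√(n : ℝ) * L) / η := by gcongr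
  rw [mul_div_assoc] at h5
  rw [roundSize]
  linarith

theorem numRounds_le (hη : 0 < η) (hη1 : η ≤ 1) (hδ : 0 < δ) (hδ1 : δ ≤ 1) (hB : η / 3 ≤ B)
    (hB1 : B < 1) : (numRounds B (δ / 2) : ℝ) ≤ 190 * ((1 + Real.log (1 / δ)) / η) := by
  have hD := one_le_one_add_log hδ hδ1
  have h8 := log_eight_div_le hδ hδ1
  set D := 1 + Real.log (1 / δ)
  have hB0 : 0 < B := by linarith
  have hlog : 0 ≤ Real.log (4 / (δ / 2)) :=
    Real.log_nonneg (by rw [le_div_iff₀ (by positivity)]; linarith)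
  have hμ : η / 63 ≤ -Real.log (1 - B / 21) := by
    have := Real.log_le_sub_one_of_pos (show 0 < 1 - B / 21 by linarith)
    linarith
  have h1 : Real.log (4 / (δ / 2)) / -Real.log (1 - B / 21) ≤ 3 * D / (η / 63) := by
    gcongr
  have h2 := (Nat.ceil_lt_add_one (div_nonneg hlog (neg_log_pos hB0 hB1).le)).le
  have h3 : 1 ≤ D / η := by
    rw [le_div_iff₀ hη]
    linarith
  have h4 : 3 * D / (η / 63) = 189 * (D / η) := by
    field_simp
    norm_num
  rw [numRounds]
  linarith

theorem log_budget_le (hn : 2 ≤ n) (hη : 0 < η) (hη1 : η ≤ 1) (hδ : 0 < δ) (hδ1 : δ ≤ 1)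
    {m t : ℝ} (hm : 1 ≤ m) (ht : 1 ≤ t)
    (hm' : m ≤ 192 * (√(n : ℝ) * (1 + Real.log (1 / η)) / η))
    (ht' : t ≤ 190 * ((1 + Real.log (1 / δ)) / η)) :
    Real.log (4 * m * t / (δ / 2)) ≤
      28 * (((1 + Real.log (1 / η)) * (1 + Real.log (1 / δ))) * Real.log n) := by
  have hL := one_le_one_add_log hη hη1
  have hD := one_le_one_add_log hδ hδ1
  have hLη : Real.log (1 / η) = (1 + Real.log (1 / η)) - 1 := by ring
  have hLδ : Real.log (1 / δ) = (1 + Real.log (1 / δ)) - 1 := by ring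
  set L := 1 + Real.log (1 / η)
  set D := 1 + Real.log (1 / δ)
  have hn' : (2 : ℝ) ≤ n := by exact_mod_cast hn
  have hlogn : Real.log 2 ≤ Real.log n := Real.log_le_log two_pos hn'
  have hlog2 := Real.log_two_gt_d9
  have hlog2' := Real.log_two_lt_d9
  have hLD : 1 ≤ L * D := one_le_mul_of_one_le_of_one_le hL hD
  have hLLD : L ≤ L * D := le_mul_of_one_le_right (by linarith) hD
  have hDLD : D ≤ L * D := le_mul_of_one_le_left (by linarith) hL
  have hsn : 0 < √(n : ℝ) := Real.sqrt_pos.2 (by linarith)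
  have h1 : 4 * m * t / (δ / 2) ≤ 2 ^ 19 * (√(n : ℝ) * (L * D) * ((1 / η) * (1 / η) * (1 / δ))) := by
    have hmt := mul_le_mul hm' ht' (by linarith) (by positivity)
    calc 4 * m * t / (δ / 2) = 8 * (m * t) * (1 / δ) := by field_simp; norm_num
      _ ≤ 8 * (192 * (√(n : ℝ) * L / η) * (190 * (D / η))) * (1 / δ) := by gcongr
      _ = 291840 * (√(n : ℝ) * (L * D) * ((1 / η) * (1 / η) * (1 / δ))) := by field_simp; norm_num
      -- `291840 ≤ 2 ^ 19`
      _ ≤ _ := by gcongr; norm_num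
  have hpos : 0 < 4 * m * t / (δ / 2) := by positivity
  have hLDpos : 0 < L * D := by linarith
  have h2 := Real.log_le_log hpos h1
  rw [Real.log_mul (by positivity) (by positivity), Real.log_mul (by positivity) (by positivity),
    Real.log_mul hsn.ne' hLDpos.ne',
    Real.log_mul (x := 1 / η * (1 / η)) (by positivity) (by positivity),
    Real.log_mul (x := 1 / η) (by positivity) (by positivity), Real.log_pow, Real.log_sqrt n.cast_nonneg,
    hLη, hLδ] at h2
  have h3 := Real.log_le_sub_one_of_pos hLDpos
  push_cast at h2
  have h4 : 0.69 * (L * D) ≤ L * D * Real.log n := by nlinarith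
  have h5 : Real.log n ≤ L * D * Real.log n := le_mul_of_one_le_left (by linarith) hLD
  linarith

theorem inside_estimate (hn : 2 ≤ n) (hη : 0 < η) (hη1 : η ≤ 1) (hδ : 0 < δ) (hδ1 : δ ≤ 1)
    (hk1 : 1 ≤ k) (hk : (k : ℝ) ≤ 6 * n * (1 + Real.log (1 / η))) (hB : η / 3 ≤ B) (hB1 : B < 1) :
    ((numRounds B (δ / 2) * (roundSize k B * (4 + ⌈2 * Real.log (4 * roundSize k B *
      numRounds B (δ / 2) / (δ / 2)) / (B / 105) ^ 2⌉₊)) : ℕ) : ℝ) ≤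
      250000000000 * ((1 + Real.log (1 / η)) * (1 + Real.log (1 / δ))) ^ 2 *
        (√(n : ℝ) * Real.log n / η ^ 4) := by
  have hB0 : 0 < B := by linarith
  have hm := roundSize_le hn hη hη1 hk1 hk hB
  have ht := numRounds_le hη hη1 hδ hδ1 hB hB1
  have hm1 : (1 : ℝ) ≤ roundSize k B := by exact_mod_cast one_le_roundSize hk1 hB0
  have ht1 : (1 : ℝ) ≤ numRounds B (δ / 2) := by
    exact_mod_cast one_le_numRounds hB0 hB1 (half_pos hδ) (by linarith)
  have hlog := log_budget_le hn hη hη1 hδ hδ1 hm1 ht1 hm ht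
  have hL := one_le_one_add_log hη hη1
  have hD := one_le_one_add_log hδ hδ1
  set L := 1 + Real.log (1 / η)
  set D := 1 + Real.log (1 / δ)
  set m := roundSize k B
  set t := numRounds B (δ / 2)
  have hn' : (2 : ℝ) ≤ n := by exact_mod_cast hn
  have hlogn : Real.log 2 ≤ Real.log n := Real.log_le_log two_pos hn'
  have hlog2 := Real.log_two_gt_d9
  have hLD : 1 ≤ L * D := one_le_mul_of_one_le_of_one_le hL hD
  set Y := Real.log (4 * m * t / (δ / 2)) with hY
  have hY0 : 0 ≤ Y := by
    refine Real.log_nonneg ?_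
    rw [le_div_iff₀ (by positivity)]
    have := one_le_mul_of_one_le_of_one_le hm1 ht1
    linarith
  have hlogn0 : 0.69 ≤ L * D * Real.log n := by nlinarith
  have hR : ((4 + ⌈2 * Y / (B / 105) ^ 2⌉₊ : ℕ) : ℝ) ≤
      5600000 * (L * D * Real.log n / η ^ 2) := by
    have h1 := (Nat.ceil_lt_add_one (show 0 ≤ 2 * Y / (B / 105) ^ 2 by positivity)).le
    have h2 : 2 * Y / (B / 105) ^ 2 ≤
        2 * (28 * (L * D * Real.log n)) / (η / 315) ^ 2 :=
      div_le_div₀ (by linarith) (by linarith) (by positivity)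
        (pow_le_pow_left₀ (by positivity) (by linarith) 2)
    have h3 : 2 * (28 * (L * D * Real.log n)) / (η / 315) ^ 2 =
        5556600 * (L * D * Real.log n / η ^ 2) := by
      field_simp
      ring
    have h4 : 0.69 ≤ L * D * Real.log n / η ^ 2 := by
      rw [le_div_iff₀ (by positivity)]
      nlinarith
    push_cast
    linarith
  rw [Nat.cast_mul, Nat.cast_mul]
  have hlogn1 : 0 ≤ Real.log n := by linarith
  calc (t : ℝ) * (m * ((4 + ⌈2 * Y / (B / 105) ^ 2⌉₊ : ℕ) : ℝ)) ≤
      190 * (D / η) * (192 * (√(n : ℝ) * L / η) * (5600000 * (L * D * Real.log n / η ^ 2))) := by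
        gcongr
    _ = 204288000000 * ((L * D) ^ 2 * (√(n : ℝ) * Real.log n / η ^ 4)) := by
        field_simp
        ring
    _ ≤ 250000000000 * ((L * D) ^ 2 * (√(n : ℝ) * Real.log n / η ^ 4)) := by
        gcongr
        norm_num
    _ = _ := by ring

end Estimates

theorem barbarik3_queriesAtMost {n : ℕ} {η ε δ : ℝ} (hn : 2 ≤ n) (hη : 0 < η) (hη1 : η ≤ 1)
    (hε : 0 ≤ ε) (hεη : ε < η / 11.6) (hδ : 0 < δ) (hδ1 : δ ≤ 1) (P Q : PMF (Cube n)) :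
    (barbarik3 n η ε δ).QueriesAtMost P Q
      (250000000000 * ((1 + Real.log (1 / η)) * (1 + Real.log (1 / δ))) ^ 2 *
        (√(n : ℝ) * Real.log n / (η ^ 3 * (η - 11.6 * ε)) + n / η ^ 2)) := by
  have hk := bucketCount_le hn hη hη1
  have hk1 := one_le_bucketCount n hη hη1
  have hout := outside_estimate hn hη hη1 hδ hδ1 hk
  set N := ⌈max (4 * (((n + ⌈Real.logb 2 (100 / η)⌉₊ : ℕ) : ℝ) + 1) / (η / 20) ^ 2)
    (8 * Real.log (4 / (δ / 2)) / (η / 20) ^ 2)⌉₊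
  set b := 250000000000 * ((1 + Real.log (1 / η)) * (1 + Real.log (1 / δ))) ^ 2 *
        (√(n : ℝ) * Real.log n / η ^ 4) with hb
  have hinside : ∀ d : ℝ, 0 ≤ d → ¬ ε / 2 + η / 20 < d →
      QueryBound (insideBucket n (n + ⌈Real.logb 2 (100 / η)⌉₊) ε (d + η / 20) η (δ / 2)) ⌊b⌋₊
        fun _ => True := by
    intro d hd hd1
    have hB := div_three_le_margin (ε₂ := d + η / 20) hη1 hε hεη (by linarith)
    have hB1 := margin_lt_one (ε₂ := d + η / 20) hη1 hε hεη (by linarith)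
    have hx := odds_le hε hη1 hεη
    have hε' : ε < 1 / 11.6 := hεη.trans_le (by gcongr)
    have hx0 : 0 ≤ 2 * ε / (1 - ε) :=
      div_nonneg (by linarith) (by norm_num at hε' ⊢; linarith)
    have hest := inside_estimate hn hη hη1 hδ hδ1 hk1 hk hB hB1
    set B := margin η ε (d + η / 20)
    have hB0 : 0 < B := by linarith
    refine (queryBound_insideBucket hx0 hB0 ?_ ?_).mono (Nat.le_floor hest) fun _ h => h
    · norm_num at hε' ⊢
      linarith
    · have hm1 : (1 : ℝ) ≤ roundSize (n + ⌈Real.logb 2 (100 / η)⌉₊) B := by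
        exact_mod_cast one_le_roundSize hk1 hB0
      have ht1 : (1 : ℝ) ≤ numRounds B (δ / 2) := by
        exact_mod_cast one_le_numRounds hB0 hB1 (half_pos hδ) (by linarith)
      refine Real.log_nonneg ?_
      rw [le_div_iff₀ (by positivity)]
      have := one_le_mul_of_one_le_of_one_le hm1 ht1
      linarith
  have hQB := (queryBound_outsideBucket (n := n)
      (queryBound_sampBP (n + ⌈Real.logb 2 (100 / η)⌉₊))
      (queryBound_sampBQ (n + ⌈Real.logb 2 (100 / η)⌉₊)) (n + ⌈Real.logb 2 (100 / η)⌉₊) (η / 20) (δ / 2)).bind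
      (f := fun d => if ε / 2 + η / 20 < d then pure Verdict.reject else
        insideBucket n (n + ⌈Real.logb 2 (100 / η)⌉₊) ε (d + η / 20) η (δ / 2))
      (c := ⌊b⌋₊) (J := fun _ => True) fun d hd => by
        split_ifs with hd1
        · trivial
        · exact hinside d hd hd1
  intro o ho
  have hle : (o.2 : ℝ) ≤ ((N * 2 + N * 2 + ⌊b⌋₊ : ℕ) : ℝ) := Nat.cast_le.2 (hQB.le_of_mem_support P Q o ho)
  refine hle.trans ?_
  have hL := one_le_one_add_log hη hη1
  have hD := one_le_one_add_log hδ hδ1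
  set L := 1 + Real.log (1 / η)
  set D := 1 + Real.log (1 / δ)
  have hLD : 1 ≤ L * D := one_le_mul_of_one_le_of_one_le hL hD
  have hlogn : 0 ≤ Real.log n := Real.log_natCast_nonneg n
  have hb0 : 0 ≤ b := by positivity
  have hgap : 0 < η - 11.6 * ε := by
    rw [lt_div_iff₀ (by norm_num)] at hεη
    linarith
  have hfloor := Nat.floor_le hb0
  have hbb : b ≤ 250000000000 * (L * D) ^ 2 *
      (√(n : ℝ) * Real.log n / (η ^ 3 * (η - 11.6 * ε))) := by
    rw [hb]
    refine mul_le_mul_of_nonneg_left ?_ (by positivity)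
    refine div_le_div_of_nonneg_left (by positivity) (by positivity) ?_
    rw [pow_succ]
    refine mul_le_mul_of_nonneg_left (by linarith) (by positivity)
  have hNN : 80000 * (L * D) * (n / η ^ 2) ≤ 250000000000 * (L * D) ^ 2 * (n / η ^ 2) := by
    refine mul_le_mul_of_nonneg_right ?_ (by positivity)
    nlinarith
  push_cast
  rw [mul_add]
  linarith

end Barbarik

theorem theorem1 :
    (∀ (n : ℕ) (η ε δ : ℝ), 0 < η → η ≤ 1 → 0 ≤ ε → ε < η / 11.6 → 0 < δ → δ ≤ 1 / 2 →
      ∀ P Q : PMF (Barbarik.Cube n),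
        (Barbarik.dInf P Q ≤ ENNReal.ofReal ε →
          ENNReal.ofReal (1 - δ) ≤
            (Barbarik.barbarik3 n η ε δ).probReturns P Q Barbarik.Verdict.accept) ∧
        (η < Barbarik.dTV P Q →
          ENNReal.ofReal (1 - δ) ≤
            (Barbarik.barbarik3 n η ε δ).probReturns P Q Barbarik.Verdict.reject)) ∧
    (∃ (C : ℝ) (c : ℕ),
      ∀ (n : ℕ) (η ε δ : ℝ), 2 ≤ n → 0 < η → η ≤ 1 → 0 ≤ ε → ε < η / 11.6 → 0 < δ → δ ≤ 1 / 2 →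
        ∀ P Q : PMF (Barbarik.Cube n),
          (Barbarik.barbarik3 n η ε δ).QueriesAtMost P Q
            (C * ((1 + Real.log (1 / η)) * (1 + Real.log (1 / δ))) ^ c *
              (√(n : ℝ) * Real.log n / (η ^ 3 * (η - 11.6 * ε)) + n / η ^ 2))) := by
  refine ⟨fun n η ε δ hη hη1 hε hεη hδ hδ2 P Q => ⟨fun h => ?_, fun h => ?_⟩,
    250000000000, 2, fun n η ε δ hn hη hη1 hε hεη hδ hδ2 P Q =>
      Barbarik.barbarik3_queriesAtMost hn hη hη1 hε hεη hδ (by linarith) P Q⟩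
  · refine Barbarik.ofReal_le_probReturns (g := Barbarik.accVal) (fun v hv => ?_) rfl
      (Barbarik.barbarik3_accepts hη hη1 hε hεη hδ (by linarith) h)
    cases v
    · exact absurd rfl hv
    · rfl
  · refine Barbarik.ofReal_le_probReturns (g := Barbarik.rejVal) (fun v hv => ?_) rfl
      (Barbarik.barbarik3_rejects hη hη1 hε hεη hδ (by linarith) h)
    cases v
    · rfl
    · exact absurd rfl hv
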